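/- Let $d\ge 2$, let $\Omega\subset\mathbb{R}^d$ be a bounded domain (non-empty, open, connected) with strongly Lipschitz boundary (near every boundary point $\Omega$ is, after a rotation, the region strictly below the graph of a Lipschitz function), and let $q=d/(d-1)$. For $u\in L^1(\Omega)$ let $$\operatorname{TV}(u,\Omega)=\sup\Big\{\int_\Omega u\,\operatorname{div}\psi\,\mathrm{d}x \;:\; \psi\in C^1_c(\Omega;\mathbb{R}^d),\ \sup_{x\in\Omega}|\psi(x)|\le 1\Big\}\in[0,\infty],$$ with $|\cdot|$ the Euclidean norm, and let $\operatorname{BV}(\Omega)=\{u\in L^1(\Omega):\operatorname{TV}(u,\Omega)<\infty\}$. Let $V\subset L^q(\Omega)$ be a weakly closed linear subspace that contains the constant function $\mathbb{1}_\Omega$, let $Y$ be a separable real Hilbert space, let $K:V\to Y$ be linear and continuous, let $F:Y\to\mathbb{R}$, put $K_{\mathbb{1}}=K\mathbb{1}_\Omega$, and assume: 1. $K$ is weak-to-strong continuous: if $u_n,u\in V$ and $u_n\rightharpoonup u$ weakly in $L^q(\Omega)$, then $Ku_n\to Ku$ strongly in $Y$. 2. $F$ is three times continuously Fréchet differentiable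 and strictly convex, and $F(y)\ge 0$ for all $y\in Y$. 3. For every $y\in Y$ the function $c\mapsto F(y+cK_{\mathbb{1}})$ has exactly one minimizer over $\mathbb{R}$. Then the problem $$\min_{u\in V}\ J(u),\qquad J(u)=F(Ku)+\operatorname{TV}(u,\Omega),$$ admits at least one minimizer: there is $\bar u\in V\cap\operatorname{BV}(\Omega)$ with $J(\bar u)\le J(v)$ for all $v\in V$. -/

import Mathlib

open MeasureTheory Filter Topology
open scoped ENNReal NNReal

noncomputable section

namespace TVMin

/-- `ℝ^d` with the Euclidean norm. -/
abbrev E (d : ℕ) : Type := EuclideanSpace ℝ (Fin d)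

/-- The exponent `q = d / (d - 1)`. -/
def critExp (d : ℕ) : ℝ≥0∞ := (d : ℝ≥0∞) / ((d : ℝ≥0∞) - 1)

instance fact_one_le_critExp (d : ℕ) [h : Fact (2 ≤ d)] : Fact (1 ≤ critExp d) := by
  refine ⟨?_⟩
  have hd : 2 ≤ d := h.out
  have h2 : ((d : ℝ≥0∞) - 1) = ((d - 1 : ℕ) : ℝ≥0∞) := by simp
  rw [critExp, h2]
  have h0 : ((d - 1 : ℕ) : ℝ≥0∞) ≠ 0 := by
    simp only [ne_eq, Nat.cast_eq_zero]; omega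
  rw [ENNReal.le_div_iff_mul_le (Or.inl h0) (Or.inl (ENNReal.natCast_ne_top _)), one_mul]
  exact_mod_cast Nat.sub_le d 1

/-- The space `L^q(Ω)`, `q = d / (d - 1)`, with respect to the Lebesgue measure. -/
abbrev LqSpace (d : ℕ) (Ω : Set (E d)) : Type := Lp ℝ (critExp d) (volume.restrict Ω)

/-- (Strongly) Lipschitz boundary: near each boundary point, after a rotation (the unit vector `e`
gives the vertical direction, and `y - ⟪e, y⟫ e` is the horizontal part of `y`), the set `Ω`
is the region strictly below the graph of a Lipschitz function of the horizontal part. -/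
def HasLipschitzBoundary {d : ℕ} (Ω : Set (E d)) : Prop :=
  ∀ x ∈ frontier Ω, ∃ (e : E d) (r : ℝ) (L : ℝ≥0) (g : E d → ℝ),
    ‖e‖ = 1 ∧ 0 < r ∧ LipschitzWith L g ∧
      ∀ y ∈ Metric.ball x r, (y ∈ Ω ↔ inner ℝ e y < g (y - inner ℝ e y • e))

/-- A bounded domain (non-empty connected open set) with strongly Lipschitz boundary. -/
structure IsBoundedLipschitzDomain {d : ℕ} (Ω : Set (E d)) : Prop where
  isOpen : IsOpen Ω
  isConnected : IsConnected Ω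
  isBounded : Bornology.IsBounded Ω
  lipschitz : HasLipschitzBoundary Ω

/-- The divergence `∑ᵢ ∂ᵢ ψᵢ` of a vector field. -/
def divergence {d : ℕ} (ψ : E d → E d) (x : E d) : ℝ :=
  ∑ i : Fin d, (fderiv ℝ ψ x (EuclideanSpace.single i 1)) i

/-- The fields `ψ ∈ C¹_c(Ω; ℝ^d)` (extended by zero) with `sup |ψ| ≤ 1`. -/
def testFields {d : ℕ} (Ω : Set (E d)) : Set (E d → E d) :=
  {ψ | ContDiff ℝ 1 ψ ∧ HasCompactSupport ψ ∧ tsupport ψ ⊆ Ω ∧ ∀ x, ‖ψ x‖ ≤ 1}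

/-- The isotropic total variation `TV(u, Ω) ∈ [0, ∞]` of `u ∈ L¹(Ω)`. The supremum contains
`ψ = 0`, so that taking positive parts of the integrals does not change it. -/
def TV {d : ℕ} (Ω : Set (E d)) (u : E d → ℝ) : ℝ≥0∞ :=
  ⨆ ψ ∈ testFields Ω, ENNReal.ofReal (∫ x in Ω, u x * divergence ψ x)

/-- `u ∈ BV(Ω)`. -/
def IsBV {d : ℕ} (Ω : Set (E d)) (u : E d → ℝ) : Prop :=
  IntegrableOn u Ω ∧ TV Ω u < ∞

/-- The function `𝟙_Ω`, constantly `1` on `Ω`, as an element of `L^q(Ω)`. -/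
def oneLq {d : ℕ} {Ω : Set (E d)} (hΩ : Bornology.IsBounded Ω) : LqSpace d Ω :=
  haveI : IsFiniteMeasure ((volume : Measure (E d)).restrict Ω) :=
    isFiniteMeasure_restrict.mpr hΩ.measure_lt_top.ne
  Lp.const (critExp d) ((volume : Measure (E d)).restrict Ω) (1 : ℝ)

section

variable {d : ℕ} [Fact (2 ≤ d)] {Ω : Set (E d)} {Y : Type*} [NormedAddCommGroup Y]
  [InnerProductSpace ℝ Y]

/-- `V` is closed in the weak topology of `L^q(Ω)`. -/
def IsWeaklyClosed (V : Submodule ℝ (LqSpace d Ω)) : Prop :=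
  IsClosed (toWeakSpace ℝ (LqSpace d Ω) '' (V : Set (LqSpace d Ω)))

/-- `K` maps sequences in `V` that converge weakly in `L^q(Ω)` to a limit in `V` to sequences
that converge strongly in `Y`, to the image of the limit. -/
def IsWeakToStrongContinuous {V : Submodule ℝ (LqSpace d Ω)} (K : V →L[ℝ] Y) : Prop :=
  ∀ (u : ℕ → V) (v : V),
    Tendsto (fun n => toWeakSpace ℝ (LqSpace d Ω) (u n : LqSpace d Ω)) atTop
      (𝓝 (toWeakSpace ℝ (LqSpace d Ω) (v : LqSpace d Ω))) →
    Tendsto (fun n => K (u n)) atTop (𝓝 (K v))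

/-- The objective `J(u) = F(K u) + TV(u, Ω)`, with values in `(-∞, ∞]`. -/
def objective {V : Submodule ℝ (LqSpace d Ω)} (K : V →L[ℝ] Y) (F : Y → ℝ) (u : V) : EReal :=
  ((F (K u) : ℝ) : EReal) + ((TV Ω (u : LqSpace d Ω) : ℝ≥0∞) : EReal)

end

end TVMin

end

/-! The proof is the direct method. Take a minimizing sequence `u n` with `J (u n) ≤ J 0 < ∞`; its
total variations are bounded. The Poincaré-Sobolev inequality `‖u - c 𝟙‖_q ≤ C TV(u)`
(`exists_norm_sub_smul_oneLq_le`) splits off constants `c n` such that `w n = u n - c n 𝟙` is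
bounded in `L^q`. A subsequence of `w n` converges weakly to some `v ∈ V` (`exists_weak_subseq`), so
`K (w n) → K v` strongly. The values `F (K (w n) + c n K𝟙)` are bounded, and a convex function with
a unique minimizer on the line `K v + ℝ K𝟙` is coercive along all nearby parallel lines
(`eventually_abs_sub_le_of_convexOn`). Hence `c n` is eventually bounded, and along a further
subsequence `u n` converges weakly to `z = v + a 𝟙`. Then `F (K (u n)) → F (K z)`, and `TV` is
weakly lower semicontinuous as a supremum of weakly continuous functionals, so `z` is a minimizer.

The Poincaré-Sobolev inequality is proved for functions with bounded `L¹` difference quotients along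
segments inside `Ω` (`TransBound`). Finite total variation gives such a bound by duality, and
subtracting constants preserves it. The `L¹` Poincaré inequality comes from chaining: sets joined by
segments in `Ω` have controlled mutual oscillation (`Linked`), and the Lipschitz boundary links
every boundary neighbourhood to an interior ball. For the Sobolev inequality, an inner cone contains
a basis; in its coordinates `Ω` is locally a lower set. There the Gagliardo-Nirenberg argument works
with half-lines descending inside the set, so no extension operator is required. Compactness of the
closure patches the local estimates together.

Weak compactness in `L^q` rests on the Riesz representation of the dual of `L^p` and on
Banach-Alaoglu for the separable conjugate space. -/

namespace TVMin

/-! ### Mollifiers -/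

/-- A sequence of bump functions at the origin whose supports shrink to the origin. -/
noncomputable def shrinkingBump {G : Type*} [NormedAddCommGroup G] [NormedSpace ℝ G]
    (δ : ℝ) (hδ : 0 < δ) (n : ℕ) : ContDiffBump (0 : G) where
  rIn := δ / (2 * (n + 1))
  rOut := δ / (n + 1)
  rIn_pos := by positivity
  rIn_lt_rOut := by
    have : (0 : ℝ) < n + 1 := by positivity
    rw [div_lt_div_iff₀ (by positivity) this]
    nlinarith

lemma tendsto_rOut_shrinkingBump {G : Type*} [NormedAddCommGroup G] [NormedSpace ℝ G]
    {δ : ℝ} (hδ : 0 < δ) :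
    Tendsto (fun n => (shrinkingBump (G := G) δ hδ n).rOut) atTop (𝓝 0) := by
  have := (tendsto_one_div_add_atTop_nhds_zero_nat (𝕜 := ℝ)).const_mul δ
  simpa [shrinkingBump, div_eq_mul_inv] using this

lemma rOut_shrinkingBump_le {G : Type*} [NormedAddCommGroup G] [NormedSpace ℝ G]
    {δ : ℝ} (hδ : 0 < δ) (n : ℕ) : (shrinkingBump (G := G) δ hδ n).rOut ≤ δ := by
  have : (0 : ℝ) ≤ n := by positivity
  simp only [shrinkingBump]
  rw [div_le_iff₀ (by positivity)]
  nlinarith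

/-- The bounded ratio of radii is what makes mollifications of locally integrable functions converge
almost everywhere, by Lebesgue differentiation. -/
lemma rOut_shrinkingBump_le_mul {G : Type*} [NormedAddCommGroup G] [NormedSpace ℝ G]
    {δ : ℝ} (hδ : 0 < δ) (n : ℕ) :
    (shrinkingBump (G := G) δ hδ n).rOut ≤ 2 * (shrinkingBump (G := G) δ hδ n).rIn := by
  have : (n : ℝ) + 1 ≠ 0 := by positivity
  simp only [shrinkingBump]
  apply le_of_eq
  field_simp

/-! ### The L¹ norm by duality with smooth functions -/

section Duality

variable {G : Type*} [NormedAddCommGroup G] [NormedSpace ℝ G] [FiniteDimensional ℝ G]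
  [MeasurableSpace G] [BorelSpace G] (μ : Measure G) [μ.IsAddHaarMeasure]

/-- The `L¹` norm on a compact set is controlled by testing against smooth functions. -/
lemma setIntegral_abs_le_of_forall_integral_mul_le {A : Set G} (hA : IsOpen A) {w : G → ℝ}
    (hwm : Measurable w) (hw : Integrable w μ) {M : ℝ}
    (hM : ∀ φ : G → ℝ, ContDiff ℝ 1 φ → HasCompactSupport φ → tsupport φ ⊆ A →
      (∀ x, ‖φ x‖ ≤ 1) → ∫ x, w x * φ x ∂μ ≤ M) {K : Set G} (hK : IsCompact K) (hKA : K ⊆ A) :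
    ∫ x in K, ‖w x‖ ∂μ ≤ M := by
  obtain ⟨δ, hδ, hδA⟩ := hK.exists_cthickening_subset_open hA hKA
  -- The ideal test function is the sign of `w` on `K`; its mollifications at scale at most `δ` are
  -- admissible and converge to it almost everywhere.
  set σ : G → ℝ := K.indicator (fun x => SignType.sign (w x) : G → ℝ) with hσ
  have hsgn : Measurable (fun x => ((SignType.sign (w x) : SignType) : ℝ)) := by
    have : Measurable (fun t : ℝ => ((SignType.sign t : SignType) : ℝ)) := by
      have h : (fun t : ℝ => ((SignType.sign t : SignType) : ℝ)) =
          fun t => (Set.Ioi (0 : ℝ)).indicator 1 t - (Set.Iio (0 : ℝ)).indicator 1 t := by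
        funext t
        rcases lt_trichotomy t 0 with h | h | h
        · simp [h, not_lt.2 h.le]
        · simp [h]
        · simp [h, not_lt.2 h.le]
      rw [h]
      exact (measurable_one.indicator measurableSet_Ioi).sub
        (measurable_one.indicator measurableSet_Iio)
    exact this.comp hwm
  have hσm : Measurable σ := hsgn.indicator hK.measurableSet
  have hsb : ∀ x, ‖((SignType.sign (w x) : SignType) : ℝ)‖ ≤ 1 := by
    intro x
    rcases SignType.sign (w x) with _ | _ | _ <;> simp
  have hσb : ∀ x, ‖σ x‖ ≤ 1 := fun x =>
    (norm_indicator_le_norm_self _ _).trans (hsb x)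
  have hσi : Integrable σ μ := by
    refine (integrable_indicator_iff hK.measurableSet).2 ?_
    exact Measure.integrableOn_of_bounded (M := 1) hK.measure_lt_top.ne
      hsgn.aestronglyMeasurable (Eventually.of_forall hsb)
  have hσs : Function.support σ ⊆ K := Set.support_indicator_subset
  set φ : ℕ → ContDiffBump (0 : G) := shrinkingBump δ hδ
  set g : ℕ → G → ℝ := fun n =>
    convolution ((φ n).normed μ) σ (ContinuousLinearMap.lsmul ℝ ℝ) μ
  have hgs : ∀ n, Function.support (g n) ⊆ Metric.cthickening δ K := by
    intro n
    refine (support_convolution_subset _).trans ?_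
    rintro _ ⟨a, ha, b, hb, rfl⟩
    refine Metric.mem_cthickening_of_dist_le _ b δ K (hσs hb) ?_
    rw [(φ n).support_normed_eq, mem_ball_zero_iff] at ha
    simpa using ha.le.trans (rOut_shrinkingBump_le hδ n)
  have hgt : ∀ n, tsupport (g n) ⊆ Metric.cthickening δ K := fun n =>
    closure_minimal (hgs n) Metric.isClosed_cthickening
  have hgc : ∀ n, HasCompactSupport (g n) := fun n =>
    hK.cthickening.of_isClosed_subset (isClosed_tsupport _) (hgt n)
  have hgd : ∀ n, ContDiff ℝ 1 (g n) := fun n =>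
    (φ n).hasCompactSupport_normed.contDiff_convolution_left _ (φ n).contDiff_normed
      hσi.locallyIntegrable
  have hgb : ∀ n x, ‖g n x‖ ≤ 1 := by
    intro n x
    rw [← (φ n).integral_normed (μ := μ)]
    refine norm_integral_le_of_norm_le (φ n).integrable_normed (Eventually.of_forall fun t => ?_)
    simp only [ContinuousLinearMap.lsmul_apply, smul_eq_mul, norm_mul]
    rw [Real.norm_of_nonneg ((φ n).nonneg_normed t)]
    exact mul_le_of_le_one_right ((φ n).nonneg_normed t) (hσb _)
  have hlim : Tendsto (fun n => ∫ x, w x * g n x ∂μ) atTop (𝓝 (∫ x, w x * σ x ∂μ)) := by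
    refine tendsto_integral_of_dominated_convergence (fun x => ‖w x‖) ?_ hw.norm ?_ ?_
    · exact fun n => hwm.aestronglyMeasurable.mul (hgd n).continuous.aestronglyMeasurable
    · refine fun n => Eventually.of_forall fun x => ?_
      rw [norm_mul]
      exact mul_le_of_le_one_right (norm_nonneg _) (hgb n x)
    · filter_upwards [ContDiffBump.ae_convolution_tendsto_right_of_locallyIntegrable (K := 2)
        (tendsto_rOut_shrinkingBump hδ) (Eventually.of_forall (rOut_shrinkingBump_le_mul hδ))
        hσi.locallyIntegrable] with x hx
      exact hx.const_mul _
  have heq : ∫ x, w x * σ x ∂μ = ∫ x in K, ‖w x‖ ∂μ := by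
    rw [← integral_indicator hK.measurableSet]
    congr 1
    funext x
    by_cases hx : x ∈ K
    · simp [hσ, hx]
    · simp [hσ, hx]
  rw [← heq]
  exact le_of_tendsto hlim (Eventually.of_forall fun n =>
    hM _ (hgd n) (hgc n) ((hgt n).trans hδA) (hgb n))

/-- Inner regularity of the finite measure with density `|w|` passes from compact subsets to `A`
itself. -/
lemma setLIntegral_enorm_le_of_forall_integral_mul_le {A : Set G} (hA : IsOpen A) {w : G → ℝ}
    (hwm : Measurable w) (hw : Integrable w μ) {M : ℝ}
    (hM : ∀ φ : G → ℝ, ContDiff ℝ 1 φ → HasCompactSupport φ → tsupport φ ⊆ A →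
      (∀ x, ‖φ x‖ ≤ 1) → ∫ x, w x * φ x ∂μ ≤ M) :
    ∫⁻ x in A, ‖w x‖ₑ ∂μ ≤ ENNReal.ofReal M := by
  have : IsFiniteMeasure (μ.withDensity fun x => ‖w x‖ₑ) :=
    isFiniteMeasure_withDensity hw.2.ne
  rw [← withDensity_apply _ hA.measurableSet, hA.measure_eq_iSup_isCompact]
  refine iSup₂_le fun K hKA => iSup_le fun hK => ?_
  rw [withDensity_apply _ hK.measurableSet]
  rw [← ofReal_integral_norm_eq_lintegral_enorm hw.integrableOn]
  exact ENNReal.ofReal_le_ofReal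
    (setIntegral_abs_le_of_forall_integral_mul_le μ hA hwm hw hM hK hKA)

end Duality

/-! ### Total variation controls difference quotients -/

variable {d : ℕ}

/-- `M` bounds all difference quotients of `f` along segments inside `Ω`. -/
def TransBound (Ω : Set (E d)) (f : E d → ℝ) (M : ℝ≥0) : Prop :=
  ∀ (A : Set (E d)) (h : E d), IsOpen A → (∀ x ∈ A, ∀ s ∈ Set.Icc (0 : ℝ) 1, x - s • h ∈ Ω) →
    ∫⁻ x in A, ‖f x - f (x - h)‖ₑ ≤ ‖h‖ₑ * M

lemma divergence_smul_const {φ : E d → ℝ} {x : E d} (hφ : DifferentiableAt ℝ φ x) (v : E d) :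
    divergence (fun y => φ y • v) x = fderiv ℝ φ x v := by
  unfold divergence
  rw [fderiv_smul_const hφ v]
  simp only [ContinuousLinearMap.smulRight_apply, PiLp.smul_apply, smul_eq_mul]
  conv_rhs => rw [← (EuclideanSpace.basisFun (Fin d) ℝ).sum_repr v, map_sum]
  simp [mul_comm]

lemma integral_mul_divergence_le {Ω : Set (E d)} {f : E d → ℝ} (hT : TV Ω f ≠ ∞)
    {ψ : E d → E d} (hψ : ψ ∈ testFields Ω) :
    ∫ x in Ω, f x * divergence ψ x ≤ (TV Ω f).toReal := by
  have h : ENNReal.ofReal (∫ x in Ω, f x * divergence ψ x) ≤ TV Ω f := le_iSup₂_of_le ψ hψ le_rfl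
  exact (ENNReal.ofReal_le_iff_le_toReal hT).1 h

/-- The fields `φ v` with `v = ± h / ‖h‖` are admissible in the definition of `TV`, and their
divergence is the derivative of `φ` along `v`. -/
lemma abs_integral_mul_fderiv_le {Ω : Set (E d)} {f : E d → ℝ} (hT : TV Ω f ≠ ∞)
    {φ : E d → ℝ} (hφ : ContDiff ℝ 1 φ) (hc : HasCompactSupport φ) (hs : tsupport φ ⊆ Ω)
    (hb : ∀ x, ‖φ x‖ ≤ 1) (h : E d) :
    ‖∫ x in Ω, f x * fderiv ℝ φ x h‖ ≤ ‖h‖ * (TV Ω f).toReal := by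
  rcases eq_or_ne h 0 with rfl | hh
  · simp
  have hn : ‖h‖ ≠ 0 := norm_ne_zero_iff.2 hh
  have key : ∀ v : E d, ‖v‖ = 1 →
      ∫ x in Ω, f x * fderiv ℝ φ x v ≤ (TV Ω f).toReal := by
    intro v hv
    have hmem : (fun y => φ y • v) ∈ testFields Ω := by
      refine ⟨hφ.smul contDiff_const, hc.smul_right, ?_, fun x => ?_⟩
      · exact (closure_mono (Function.support_smul_subset_left φ fun _ => v)).trans hs
      · rw [norm_smul, hv, mul_one]; exact hb x
    have := integral_mul_divergence_le hT hmem
    simpa only [divergence_smul_const (hφ.differentiable one_ne_zero _)] using this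
  have h1 := key (‖h‖⁻¹ • h) (by rw [norm_smul, norm_inv, norm_norm, inv_mul_cancel₀ hn])
  have h2 := key (-(‖h‖⁻¹ • h)) (by
    rw [norm_neg, norm_smul, norm_inv, norm_norm, inv_mul_cancel₀ hn])
  simp only [map_neg, map_smul, smul_eq_mul, mul_neg, integral_neg, mul_left_comm (f _),
    integral_const_mul] at h1 h2
  have hpos : 0 < ‖h‖ := norm_pos_iff.2 hh
  rw [Real.norm_eq_abs, abs_le]
  constructor
  · have := mul_le_mul_of_nonneg_left h2 hpos.le
    rw [mul_neg, ← mul_assoc, mul_inv_cancel₀ hn, one_mul] at this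
    linarith
  · have := mul_le_mul_of_nonneg_left h1 hpos.le
    rwa [← mul_assoc, mul_inv_cancel₀ hn, one_mul] at this

/-- Differentiate `s ↦ ∫ f(x) φ(x + s h)` on `[0, 1]`. Each translate of `φ` is still supported in
`Ω` because segments from `A` in direction `-h` stay there, so `TV` bounds the derivative and the
mean value inequality applies. -/
lemma abs_integral_mul_translate_sub_le {Ω : Set (E d)} {f : E d → ℝ} (hf : Integrable f)
    (hf0 : ∀ x ∉ Ω, f x = 0)
    (hT : TV Ω f ≠ ∞) {A : Set (E d)} {h : E d}
    (hA : ∀ x ∈ A, ∀ s ∈ Set.Icc (0 : ℝ) 1, x - s • h ∈ Ω)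
    {φ : E d → ℝ} (hφ : ContDiff ℝ 1 φ) (hc : HasCompactSupport φ) (hs : tsupport φ ⊆ A)
    (hb : ∀ x, ‖φ x‖ ≤ 1) :
    ‖(∫ x, f x * φ (x + h)) - ∫ x, f x * φ x‖ ≤ ‖h‖ * (TV Ω f).toReal := by
  have hd := hφ.differentiable one_ne_zero
  have hfd : Continuous (fderiv ℝ φ) := hφ.continuous_fderiv one_ne_zero
  obtain ⟨C, hC⟩ := hfd.bounded_above_of_compact_support (hc.fderiv ℝ)
  have hderiv : ∀ s : ℝ, HasDerivAt (fun s : ℝ => ∫ x, f x * φ (x + s • h))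
      (∫ x, f x * fderiv ℝ φ (x + s • h) h) s := by
    intro s
    refine (hasDerivAt_integral_of_dominated_loc_of_deriv_le (s := Set.univ)
      (F := fun (s : ℝ) x => f x * φ (x + s • h))
      (F' := fun (s : ℝ) x => f x * fderiv ℝ φ (x + s • h) h)
      (bound := fun x => ‖f x‖ * (C * ‖h‖)) univ_mem ?_ ?_ ?_ ?_ ?_ ?_).2
    · refine Eventually.of_forall fun t => hf.aestronglyMeasurable.mul ?_
      exact (hφ.continuous.comp (by fun_prop)).aestronglyMeasurable
    · refine hf.mul_bdd (c := 1) ?_ (Eventually.of_forall fun x => hb _)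
      exact (hφ.continuous.comp (by fun_prop)).aestronglyMeasurable
    · refine hf.aestronglyMeasurable.mul (Continuous.aestronglyMeasurable ?_)
      exact (hfd.comp (by fun_prop)).clm_apply continuous_const
    · refine Eventually.of_forall fun x t _ => ?_
      rw [norm_mul]
      exact mul_le_mul_of_nonneg_left
        (((fderiv ℝ φ (x + t • h)).le_opNorm h).trans
          (mul_le_mul_of_nonneg_right (hC _) (norm_nonneg _))) (norm_nonneg _)
    · exact hf.norm.mul_const _
    · refine Eventually.of_forall fun x t _ => ?_
      have h1 : HasDerivAt (fun t : ℝ => x + t • h) h t := by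
        simpa using ((hasDerivAt_id t).smul_const h).const_add x
      exact ((hd (x + t • h)).hasFDerivAt.comp_hasDerivAt t h1).const_mul (f x)
  have hbound : ∀ s ∈ Set.Ico (0 : ℝ) 1,
      ‖∫ x, f x * fderiv ℝ φ (x + s • h) h‖ ≤ ‖h‖ * (TV Ω f).toReal := by
    intro s hs'
    set χ : E d → ℝ := fun x => φ (x + s • h) with hχ
    have hχd : ContDiff ℝ 1 χ := hφ.comp (contDiff_id.add contDiff_const)
    have hχt : tsupport χ = (Homeomorph.addRight (s • h)) ⁻¹' tsupport φ :=
      tsupport_comp_eq_preimage φ (Homeomorph.addRight (s • h))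
    have hχs : tsupport χ ⊆ Ω := by
      rw [hχt]
      intro x hx
      have := hA _ (hs hx) s ⟨hs'.1, hs'.2.le⟩
      simpa using this
    have hχc : HasCompactSupport χ := hc.comp_homeomorph (Homeomorph.addRight (s • h))
    have := abs_integral_mul_fderiv_le hT hχd hχc hχs (fun x => hb _) h
    have he : ∫ x in Ω, f x * fderiv ℝ χ x h = ∫ x, f x * fderiv ℝ φ (x + s • h) h := by
      rw [setIntegral_eq_integral_of_forall_compl_eq_zero]
      · simp only [hχ, fderiv_comp_add_right]
      · intro x hx
        simp [hf0 x hx]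
    rwa [he] at this
  have := norm_image_sub_le_of_norm_deriv_le_segment_01'
    (fun s _ => (hderiv s).hasDerivWithinAt) hbound
  simpa using this

/-- The total variation bounds the difference quotients. -/
theorem transBound_TV {Ω : Set (E d)} {f : E d → ℝ} (hfm : Measurable f) (hf : Integrable f)
    (hf0 : ∀ x ∉ Ω, f x = 0) (hT : TV Ω f ≠ ∞) : TransBound Ω f (TV Ω f).toNNReal := by
  intro A h hA hAΩ
  have hm' : Measurable fun x => f (x - h) := hfm.comp (measurable_id.sub_const h)
  have hi' : Integrable fun x => f (x - h) := hf.comp_sub_right h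
  refine (setLIntegral_enorm_le_of_forall_integral_mul_le volume hA (hfm.sub hm') (hf.sub hi')
    (M := ‖h‖ * (TV Ω f).toReal) ?_).trans_eq ?_
  · intro φ hφ hc hs hb
    have hφm : AEStronglyMeasurable φ (volume : Measure (E d)) :=
      hφ.continuous.aestronglyMeasurable
    have h1 : ∫ x, (f x - f (x - h)) * φ x = (∫ x, f x * φ x) - ∫ x, f x * φ (x + h) := by
      simp only [sub_mul]
      rw [integral_sub]
      · congr 1
        rw [← integral_add_right_eq_self _ h]
        simp
      · exact hf.mul_bdd hφm (Eventually.of_forall hb)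
      · exact hi'.mul_bdd hφm (Eventually.of_forall hb)
    have := abs_integral_mul_translate_sub_le hf hf0 hT hAΩ hφ hc hs hb
    simp only [Pi.sub_apply]
    rw [h1]
    rw [norm_sub_rev] at this
    exact (le_abs_self _).trans this
  · rw [ENNReal.ofReal_mul (norm_nonneg _), ofReal_norm, ENNReal.ofReal_toReal hT,
      ENNReal.coe_toNNReal hT]

/-! ### Oscillation between linked sets -/

/-- The mean oscillation between `A` and `B` is controlled by the difference quotients in `Ω`. -/
def Linked (Ω A B : Set (E d)) : Prop :=
  ∃ C : ℝ≥0, ∀ (f : E d → ℝ) (M : ℝ≥0), Measurable f → TransBound Ω f M →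
    ∫⁻ x in A, ∫⁻ y in B, ‖f x - f y‖ₑ ≤ C * M

lemma Linked.mono {Ω A A' B B' : Set (E d)} (h : Linked Ω A B) (hA : A' ⊆ A) (hB : B' ⊆ B) :
    Linked Ω A' B' := by
  obtain ⟨C, hC⟩ := h
  refine ⟨C, fun f M hf hM => le_trans ?_ (hC f M hf hM)⟩
  exact (lintegral_mono fun x => lintegral_mono_set hB).trans (lintegral_mono_set hA)

lemma measurable_enorm_sub {f : E d → ℝ} (hf : Measurable f) :
    Measurable fun p : E d × E d => ‖f p.1 - f p.2‖ₑ :=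
  ((hf.comp measurable_fst).sub (hf.comp measurable_snd)).enorm

lemma Linked.symm {Ω A B : Set (E d)} (h : Linked Ω A B) : Linked Ω B A := by
  obtain ⟨C, hC⟩ := h
  refine ⟨C, fun f M hf hM => le_trans (le_of_eq ?_) (hC f M hf hM)⟩
  rw [lintegral_lintegral_swap]
  · refine lintegral_congr fun x => lintegral_congr fun y => ?_
    rw [← enorm_neg, neg_sub]
  · exact (measurable_enorm_sub hf).aemeasurable

lemma Linked.union {Ω A A' B : Set (E d)} (h : Linked Ω A B) (h' : Linked Ω A' B) :
    Linked Ω (A ∪ A') B := by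
  obtain ⟨C, hC⟩ := h
  obtain ⟨C', hC'⟩ := h'
  refine ⟨C + C', fun f M hf hM => (lintegral_union_le _ _ _).trans ?_⟩
  rw [ENNReal.coe_add, add_mul]
  exact add_le_add (hC f M hf hM) (hC' f M hf hM)

/-- Average the triangle inequality through `f y` over `y ∈ B`; the positive volume of `B` permits
the division. -/
lemma Linked.trans {Ω A B D : Set (E d)} (h : Linked Ω A B) (h' : Linked Ω B D)
    (hA : volume A ≠ ∞) (hB : volume B ≠ 0) (hB' : volume B ≠ ∞) (hD : volume D ≠ ∞) :
    Linked Ω A D := by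
  obtain ⟨C, hC⟩ := h
  obtain ⟨C', hC'⟩ := h'
  refine ⟨(volume B).toNNReal⁻¹ * ((volume D).toNNReal * C + (volume A).toNNReal * C'),
    fun f M hf hM => ?_⟩
  have hm := measurable_enorm_sub hf
  have h0 : (volume B).toNNReal ≠ 0 := by simp [ENNReal.toNNReal_eq_zero_iff, hB, hB']
  have hmx : ∀ x, Measurable fun z => ‖f x - f z‖ₑ := fun x => (hf.const_sub (f x)).enorm
  have key : volume B * ∫⁻ x in A, ∫⁻ z in D, ‖f x - f z‖ₑ ≤
      volume D * (∫⁻ x in A, ∫⁻ y in B, ‖f x - f y‖ₑ) +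
        volume A * (∫⁻ y in B, ∫⁻ z in D, ‖f y - f z‖ₑ) := by
    have hpt : ∀ x, volume B * ∫⁻ z in D, ‖f x - f z‖ₑ ≤
        volume D * (∫⁻ y in B, ‖f x - f y‖ₑ) + ∫⁻ y in B, ∫⁻ z in D, ‖f y - f z‖ₑ := by
      intro x
      calc volume B * ∫⁻ z in D, ‖f x - f z‖ₑ
          = ∫⁻ _ in B, ∫⁻ z in D, ‖f x - f z‖ₑ := by rw [setLIntegral_const, mul_comm]
        _ ≤ ∫⁻ y in B, (volume D * ‖f x - f y‖ₑ + ∫⁻ z in D, ‖f y - f z‖ₑ) := by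
            refine lintegral_mono fun y => ?_
            calc ∫⁻ z in D, ‖f x - f z‖ₑ ≤ ∫⁻ z in D, (‖f x - f y‖ₑ + ‖f y - f z‖ₑ) := by
                  refine lintegral_mono fun z => ?_
                  have := enorm_add_le (f x - f y) (f y - f z)
                  rwa [sub_add_sub_cancel] at this
              _ = _ := by
                  rw [lintegral_add_left measurable_const, setLIntegral_const, mul_comm]
        _ = _ := by
            rw [lintegral_add_left ((hmx x).const_mul _), lintegral_const_mul _ (hmx x)]
    calc volume B * ∫⁻ x in A, ∫⁻ z in D, ‖f x - f z‖ₑ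
        = ∫⁻ x in A, volume B * ∫⁻ z in D, ‖f x - f z‖ₑ := by
          rw [lintegral_const_mul _ hm.lintegral_prod_right']
      _ ≤ _ := lintegral_mono hpt
      _ = _ := by
          rw [lintegral_add_right _ measurable_const, setLIntegral_const,
            lintegral_const_mul _ hm.lintegral_prod_right', mul_comm (volume A)]
  have key2 : volume B * ∫⁻ x in A, ∫⁻ z in D, ‖f x - f z‖ₑ ≤
      volume D * (C * M) + volume A * (C' * M) :=
    key.trans (add_le_add (mul_le_mul_right (hC f M hf hM) _)
      (mul_le_mul_right (hC' f M hf hM) _))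
  rw [ENNReal.coe_mul, ENNReal.coe_add, ENNReal.coe_mul, ENNReal.coe_mul, ENNReal.coe_inv h0,
    ENNReal.coe_toNNReal hB', ENNReal.coe_toNNReal hA, ENNReal.coe_toNNReal hD, mul_assoc]
  rw [← ENNReal.div_eq_inv_mul, ENNReal.le_div_iff_mul_le (Or.inl hB) (Or.inl hB'), mul_comm]
  refine key2.trans (le_of_eq ?_)
  ring

/-- Substituting `y = x - h` turns the double integral into an integral over `h` of difference
quotient integrals on `A ∩ (B + h)`, each at most `‖h‖ M`. Only bounded `h` contribute. -/
lemma linked_of_segments {Ω A B : Set (E d)} (hA : IsOpen A) (hB : IsOpen B)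
    (hA' : Bornology.IsBounded A) (hB' : Bornology.IsBounded B)
    (hseg : ∀ a ∈ A, ∀ b ∈ B, ∀ s ∈ Set.Icc (0 : ℝ) 1, a - s • (a - b) ∈ Ω) : Linked Ω A B := by
  obtain ⟨R, hR⟩ := (hA'.union hB').subset_closedBall (0 : E d)
  have hdist : ∀ a ∈ A, ∀ b ∈ B, ‖a - b‖ ≤ R + R := fun a ha b hb =>
    (norm_sub_le a b).trans (add_le_add
      (mem_closedBall_zero_iff.1 (hR (Or.inl ha))) (mem_closedBall_zero_iff.1 (hR (Or.inr hb))))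
  refine ⟨(volume (Metric.closedBall (0 : E d) (R + R))).toNNReal * (R + R).toNNReal,
    fun f M hf hM => ?_⟩
  set g : E d → E d → ℝ≥0∞ := fun x y =>
    (A ×ˢ B).indicator (fun p : E d × E d => ‖f p.1 - f p.2‖ₑ) (x, y) with hg
  have hgm : Measurable (Function.uncurry g) := by
    have : Function.uncurry g =
        (A ×ˢ B).indicator (fun p : E d × E d => ‖f p.1 - f p.2‖ₑ) := rfl
    rw [this]
    exact (measurable_enorm_sub hf).indicator (hA.measurableSet.prod hB.measurableSet)
  have h1 : ∫⁻ x in A, ∫⁻ y in B, ‖f x - f y‖ₑ = ∫⁻ x, ∫⁻ y, g x y := by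
    rw [← lintegral_indicator hA.measurableSet]
    refine lintegral_congr fun x => ?_
    by_cases hx : x ∈ A
    · rw [Set.indicator_of_mem hx, ← lintegral_indicator hB.measurableSet]
      refine lintegral_congr fun y => ?_
      by_cases hy : y ∈ B <;> simp [hg, hx, hy]
    · rw [Set.indicator_of_notMem hx]
      simp [hg, hx]
  have h2 : ∫⁻ x, ∫⁻ y, g x y = ∫⁻ h, ∫⁻ x, g x (x - h) := by
    rw [lintegral_lintegral_swap (f := fun h x => g x (x - h))]
    · exact lintegral_congr fun x => (lintegral_sub_left_eq_self (g x) x).symm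
    · exact (hgm.comp ((measurable_snd).prodMk (measurable_snd.sub measurable_fst))).aemeasurable
  have h3 : ∀ h, ∫⁻ x, g x (x - h) ≤
      (Metric.closedBall (0 : E d) (R + R)).indicator (fun _ => ENNReal.ofReal (R + R) * M) h := by
    intro h
    have hcont : Continuous fun x : E d => x - h := continuous_id.sub continuous_const
    by_cases hh : h ∈ Metric.closedBall (0 : E d) (R + R)
    · rw [Set.indicator_of_mem hh]
      have hopen : IsOpen (A ∩ (fun x => x - h) ⁻¹' B) := hA.inter (hB.preimage hcont)
      have h4 : ∫⁻ x, g x (x - h) =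
          ∫⁻ x in A ∩ (fun x => x - h) ⁻¹' B, ‖f x - f (x - h)‖ₑ := by
        rw [← lintegral_indicator hopen.measurableSet]
        refine lintegral_congr fun x => ?_
        by_cases hx : x ∈ A <;> by_cases hy : x - h ∈ B <;> simp [hg, hx, hy]
      rw [h4]
      refine (hM _ h hopen fun x hx s hs => ?_).trans ?_
      · have := hseg x hx.1 (x - h) hx.2 s hs
        simpa using this
      · gcongr
        rw [← ofReal_norm]
        exact ENNReal.ofReal_le_ofReal (mem_closedBall_zero_iff.1 hh)
    · rw [Set.indicator_of_notMem hh, nonpos_iff_eq_zero]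
      have : ∀ x, g x (x - h) = 0 := by
        intro x
        refine Set.indicator_of_notMem (fun hx => hh ?_) _
        have := hdist x hx.1 (x - h) hx.2
        simpa using this
      simp [this]
  rw [h1, h2]
  refine (lintegral_mono h3).trans (le_of_eq ?_)
  rw [lintegral_indicator Metric.isClosed_closedBall.measurableSet, setLIntegral_const,
    ENNReal.coe_mul, ENNReal.coe_toNNReal measure_closedBall_lt_top.ne, ENNReal.ofReal]
  ring

lemma linked_of_convex {Ω A B D : Set (E d)} (hA : IsOpen A) (hB : IsOpen B)
    (hA' : Bornology.IsBounded A) (hB' : Bornology.IsBounded B) (hD : Convex ℝ D) (hDΩ : D ⊆ Ω)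
    (hAD : A ⊆ D) (hBD : B ⊆ D) : Linked Ω A B := by
  refine linked_of_segments hA hB hA' hB' fun a ha b hb s hs => hDΩ ?_
  have := hD (hAD ha) (hBD hb) (sub_nonneg.2 hs.2) hs.1 (by ring)
  convert this using 1
  module

/-! ### Inner cones of Lipschitz domains -/

/-- Near `x`, the set `Ω` is stable under translations by the vectors of an open cone. -/
def HasInnerCone (Ω : Set (E d)) (x : E d) : Prop :=
  ∃ (e : E d) (δ r : ℝ) (U : Set (E d)), 0 < δ ∧ 0 < r ∧ IsOpen U ∧
    U ∩ Metric.ball x r = Ω ∩ Metric.ball x r ∧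
    ∀ y ∈ U, ∀ v ∈ Metric.ball e δ, ∀ s : ℝ, 0 ≤ s → y - s • v ∈ U

lemma hasInnerCone_of_mem {Ω : Set (E d)} (hΩ : IsOpen Ω) {x : E d} (hx : x ∈ Ω) :
    HasInnerCone Ω x := by
  obtain ⟨r, hr, hrΩ⟩ := Metric.isOpen_iff.1 hΩ x hx
  refine ⟨0, 1, r, Set.univ, one_pos, hr, isOpen_univ, ?_, fun _ _ _ _ _ _ => trivial⟩
  rw [Set.univ_inter, Set.inter_eq_right.2 hrΩ]

lemma hasInnerCone_of_mem_frontier {Ω : Set (E d)} (hΩ : HasLipschitzBoundary Ω) {x : E d}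
    (hx : x ∈ frontier Ω) : HasInnerCone Ω x := by
  obtain ⟨e, r, L, g, he, hr, hg, hΩr⟩ := hΩ x hx
  set P : E d → E d := fun y => y - inner ℝ e y • e with hP
  have hPc : Continuous P := by fun_prop
  -- For `‖v - e‖ < δ` the height of `v` exceeds `1 - δ` and its horizontal part has norm at most `2
  -- δ`. Moving by `-v` stays below the graph if the height is at least `L` times the horizontal
  -- part, which `(2 L + 1) δ ≤ 1` ensures.
  refine ⟨e, 1 / (2 * L + 1), r, {y | inner ℝ e y < g (P y)}, by positivity, hr,
    isOpen_lt (by fun_prop) (hg.continuous.comp hPc), ?_, ?_⟩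
  · ext y
    constructor
    · rintro ⟨h1, h2⟩
      exact ⟨(hΩr y h2).2 h1, h2⟩
    · rintro ⟨h1, h2⟩
      exact ⟨(hΩr y h2).1 h1, h2⟩
  · intro y hy v hv s hs
    have hy' : inner ℝ e y < g (P y) := hy
    change inner ℝ e (y - s • v) < g (P (y - s • v))
    have hee : inner ℝ e e = (1 : ℝ) := by rw [real_inner_self_eq_norm_sq, he]; norm_num
    have hv' : ‖v - e‖ < 1 / (2 * L + 1) := by simpa [dist_eq_norm] using hv
    have hin : |inner ℝ e (v - e)| ≤ ‖v - e‖ := by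
      simpa [he] using abs_real_inner_le_norm e (v - e)
    have hev : inner ℝ e v = 1 + inner ℝ e (v - e) := by rw [inner_sub_right, hee]; ring
    have hPv : ‖P v‖ ≤ 2 * ‖v - e‖ := by
      have : P v = (v - e) - inner ℝ e (v - e) • e := by
        rw [hP]; simp only [inner_sub_right, hee]; module
      rw [this]
      refine (norm_sub_le _ _).trans ?_
      rw [norm_smul, he, mul_one, Real.norm_eq_abs]
      linarith
    have hPs : P (y - s • v) = P y - s • P v := by
      simp only [hP, inner_sub_right, inner_smul_right]; module
    have hlip : g (P y) - g (P (y - s • v)) ≤ L * (s * ‖P v‖) := by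
      have := hg.dist_le_mul (P y) (P (y - s • v))
      rw [hPs, dist_eq_norm (P y), sub_sub_cancel, norm_smul, Real.norm_of_nonneg hs] at this
      rw [hPs]
      exact (le_abs_self _).trans this
    have hL : (0 : ℝ) ≤ L := L.2
    have hcone : L * ‖P v‖ ≤ inner ℝ e v := by
      rw [hev]
      have h1 : ‖v - e‖ * (2 * L + 1) < 1 := by
        rwa [lt_div_iff₀ (by positivity)] at hv'
      have h2 := neg_le_of_abs_le hin
      nlinarith [mul_le_mul_of_nonneg_left hPv hL]
    rw [inner_sub_right, inner_smul_right]
    nlinarith [mul_le_mul_of_nonneg_left hcone hs]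

lemma IsBoundedLipschitzDomain.hasInnerCone {Ω : Set (E d)} (hΩ : IsBoundedLipschitzDomain Ω)
    {x : E d} (hx : x ∈ closure Ω) : HasInnerCone Ω x := by
  by_cases h : x ∈ Ω
  · exact hasInnerCone_of_mem hΩ.isOpen h
  · refine hasInnerCone_of_mem_frontier hΩ.lipschitz ?_
    rw [hΩ.isOpen.frontier_eq]
    exact ⟨hx, h⟩

/-- A small ball about `x - ρ e` is seen from every point of `Ω` near `x` in a direction of the
cone, so the connecting segments remain in `U` and in the ball of radius `r`, hence in `Ω`. -/
lemma HasInnerCone.exists_linked {Ω : Set (E d)} (hΩ : IsOpen Ω) {x : E d}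
    (h : HasInnerCone Ω x) (hx : x ∈ closure Ω) :
    ∃ ε > 0, ∃ b, Metric.ball b ε ⊆ Ω ∧ Linked Ω (Ω ∩ Metric.ball x ε) (Metric.ball b ε) := by
  obtain ⟨e, δ, r, U, hδ, hr, hU, hUΩ, hcone⟩ := h
  have hen : 0 ≤ ‖e‖ := norm_nonneg e
  obtain ⟨ρ, hρ, hρr⟩ : ∃ ρ > 0, ρ * (‖e‖ + δ) < r :=
    ⟨r / (2 * (‖e‖ + δ)), by positivity, by field_simp; norm_num⟩
  -- Two errors of size `ρ δ / 2`, in `a` and in `b`, displace `(a - b) / ρ` from `e` by less than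
  -- `δ`.
  have hε : 0 < ρ * δ / 2 := by positivity
  have hseg : ∀ a ∈ Ω ∩ Metric.ball x (ρ * δ / 2), ∀ b ∈ Metric.ball (x - ρ • e) (ρ * δ / 2),
      ∀ s ∈ Set.Icc (0 : ℝ) 1, a - s • (a - b) ∈ Ω := by
    intro a ha b hb s hs
    have ha' : ‖a - x‖ < ρ * δ / 2 := by simpa [dist_eq_norm] using ha.2
    have hb' : ‖b - (x - ρ • e)‖ < ρ * δ / 2 := by simpa [dist_eq_norm] using hb
    have har : a ∈ Metric.ball x r := by
      rw [Metric.mem_ball, dist_eq_norm]; nlinarith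
    have hbr : b ∈ Metric.ball x r := by
      rw [Metric.mem_ball, dist_eq_norm]
      have : b - x = (b - (x - ρ • e)) - ρ • e := by module
      rw [this]
      refine (norm_sub_le _ _).trans_lt ?_
      rw [norm_smul, Real.norm_of_nonneg hρ.le]
      nlinarith
    have hball : a - s • (a - b) ∈ Metric.ball x r := by
      have := convex_ball x r har hbr (sub_nonneg.2 hs.2) hs.1 (by ring)
      convert this using 1
      module
    have haU : a ∈ U := (hUΩ.symm ▸ (⟨ha.1, har⟩ : a ∈ Ω ∩ Metric.ball x r) :
      a ∈ U ∩ Metric.ball x r).1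
    have hv : ρ⁻¹ • (a - b) ∈ Metric.ball e δ := by
      rw [Metric.mem_ball, dist_eq_norm]
      have : ρ⁻¹ • (a - b) - e = ρ⁻¹ • ((a - x) - (b - (x - ρ • e))) := by
        rw [show (a - x) - (b - (x - ρ • e)) = (a - b) - ρ • e by module, smul_sub ρ⁻¹ (a - b),
          inv_smul_smul₀ hρ.ne']
      rw [this, norm_smul, norm_inv, Real.norm_of_nonneg hρ.le, inv_mul_lt_iff₀ hρ]
      exact (norm_sub_le _ _).trans_lt (by linarith)
    have := hcone a haU _ hv (s * ρ) (mul_nonneg hs.1 hρ.le)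
    rw [smul_smul, mul_assoc, mul_inv_cancel₀ hρ.ne', mul_one] at this
    exact (hUΩ ▸ (⟨this, hball⟩ : a - s • (a - b) ∈ U ∩ Metric.ball x r) :
      a - s • (a - b) ∈ Ω ∩ Metric.ball x r).1
  refine ⟨ρ * δ / 2, hε, x - ρ • e, ?_, ?_⟩
  · obtain ⟨a, ha, hax⟩ := Metric.mem_closure_iff.1 hx _ hε
    intro b hb
    have := hseg a ⟨ha, by rwa [Metric.mem_ball, dist_comm]⟩ b hb 1 ⟨zero_le_one, le_rfl⟩
    simpa using this
  · exact linked_of_segments (hΩ.inter Metric.isOpen_ball) Metric.isOpen_ball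
      (Metric.isBounded_ball.subset Set.inter_subset_right) Metric.isBounded_ball hseg

/-! ### Chaining and the L¹ Poincaré inequality -/

/-- All small balls in a connected open set are linked to each other. -/
lemma exists_linked_ball {Ω : Set (E d)} (hΩ : IsOpen Ω) (hc : IsConnected Ω) {x₀ : E d}
    {ε₀ : ℝ} (hε₀ : 0 < ε₀) (hx₀ : Metric.ball x₀ ε₀ ⊆ Ω) {x : E d} (hx : x ∈ Ω) :
    ∃ ε > 0, Metric.ball x ε ⊆ Ω ∧ Linked Ω (Metric.ball x ε) (Metric.ball x₀ ε₀) := by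
  set u : Set (E d) :=
    {x | ∃ ε > 0, Metric.ball x ε ⊆ Ω ∧ Linked Ω (Metric.ball x ε) (Metric.ball x₀ ε₀)}
  have hsub : ∀ {y z : E d} {r : ℝ}, z ∈ Metric.ball y r →
      ∃ ε > 0, Metric.ball z ε ⊆ Metric.ball y r := fun hz =>
    Metric.isOpen_iff.1 Metric.isOpen_ball _ hz
  have hu : IsOpen u := by
    rw [Metric.isOpen_iff]
    rintro y ⟨ε, hε, h1, h2⟩
    refine ⟨ε, hε, fun z hz => ?_⟩
    obtain ⟨ε', hε', hz'⟩ := hsub hz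
    exact ⟨ε', hε', hz'.trans h1, h2.mono hz' le_rfl⟩
  -- Connectedness: the open set `u` meets `Ω` and is closed relative to `Ω`. For a limit point `y`,
  -- a small ball around a nearby point of `u` serves as the intermediate link.
  refine hc.isPreconnected.subset_of_closure_inter_subset hu ?_ ?_ hx
  · refine ⟨x₀, hx₀ (Metric.mem_ball_self hε₀), ε₀, hε₀, hx₀, ?_⟩
    exact linked_of_convex Metric.isOpen_ball Metric.isOpen_ball Metric.isBounded_ball
      Metric.isBounded_ball (convex_ball x₀ ε₀) hx₀ le_rfl le_rfl
  · rintro y ⟨hyu, hyΩ⟩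
    obtain ⟨r, hr, hrΩ⟩ := Metric.isOpen_iff.1 hΩ y hyΩ
    obtain ⟨z, ⟨ε, hε, -, hlink⟩, hzy⟩ := Metric.mem_closure_iff.1 hyu r hr
    obtain ⟨ε', hε', hz'⟩ := hsub (show z ∈ Metric.ball y r by rwa [Metric.mem_ball, dist_comm])
    have hmin : 0 < min ε ε' := lt_min hε hε'
    refine ⟨r, hr, hrΩ, Linked.trans (B := Metric.ball z (min ε ε')) ?_
      (hlink.mono (Metric.ball_subset_ball (min_le_left _ _)) le_rfl)
      measure_ball_lt_top.ne (Metric.measure_ball_pos _ _ hmin).ne' measure_ball_lt_top.ne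
      measure_ball_lt_top.ne⟩
    exact linked_of_convex Metric.isOpen_ball Metric.isOpen_ball Metric.isBounded_ball
      Metric.isBounded_ball (convex_ball y r) hrΩ le_rfl
      ((Metric.ball_subset_ball (min_le_right _ _)).trans hz')

/-- The `L¹` Poincaré inequality on a bounded Lipschitz domain. -/
theorem IsBoundedLipschitzDomain.exists_poincare {Ω : Set (E d)}
    (hΩ : IsBoundedLipschitzDomain Ω) :
    ∃ C : ℝ≥0, ∀ (f : E d → ℝ) (M : ℝ≥0), Measurable f → TransBound Ω f M →
      ∃ c : ℝ, ∫⁻ x in Ω, ‖f x - c‖ₑ ≤ C * M := by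
  obtain ⟨x₀, hx₀⟩ := hΩ.isConnected.nonempty
  obtain ⟨ε₀, hε₀, hball⟩ := Metric.isOpen_iff.1 hΩ.isOpen x₀ hx₀
  have hloc : ∀ x ∈ closure Ω, ∃ ε > 0,
      Linked Ω (Ω ∩ Metric.ball x ε) (Metric.ball x₀ ε₀) := by
    intro x hx
    obtain ⟨ε, hε, b, hb, hlink⟩ := (hΩ.hasInnerCone hx).exists_linked hΩ.isOpen hx
    obtain ⟨ε', hε', -, hlink'⟩ := exists_linked_ball hΩ.isOpen hΩ.isConnected hε₀ hball
      (hb (Metric.mem_ball_self hε))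
    have hmin : 0 < min ε ε' := lt_min hε hε'
    refine ⟨ε, hε, Linked.trans (B := Metric.ball b (min ε ε'))
      (hlink.mono le_rfl (Metric.ball_subset_ball (min_le_left _ _)))
      (hlink'.mono (Metric.ball_subset_ball (min_le_right _ _)) le_rfl)
      ((hΩ.isBounded.subset Set.inter_subset_left).measure_lt_top.ne)
      (Metric.measure_ball_pos _ _ hmin).ne' measure_ball_lt_top.ne measure_ball_lt_top.ne⟩
  -- Writing `Ω` as `Ω ∩ closure Ω` lets compactness of the closure glue finitely many local links.
  have hlink : Linked Ω (Ω ∩ closure Ω) (Metric.ball x₀ ε₀) := by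
    refine hΩ.isBounded.isCompact_closure.induction_on
      (p := fun s => Linked Ω (Ω ∩ s) (Metric.ball x₀ ε₀)) ⟨0, by simp⟩ ?_ ?_ ?_
    · exact fun s t hst h => h.mono (Set.inter_subset_inter_right _ hst) le_rfl
    · intro s t hs ht
      rw [Set.inter_union_distrib_left]
      exact hs.union ht
    · intro x hx
      obtain ⟨ε, hε, h⟩ := hloc x hx
      exact ⟨_, mem_nhdsWithin_of_mem_nhds (Metric.ball_mem_nhds x hε), h⟩
  rw [Set.inter_eq_left.2 subset_closure] at hlink
  obtain ⟨C, hC⟩ := hlink.symm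
  have hv0 : volume (Metric.ball x₀ ε₀) ≠ 0 := (Metric.measure_ball_pos _ _ hε₀).ne'
  have hv1 : volume (Metric.ball x₀ ε₀) ≠ ∞ := measure_ball_lt_top.ne
  refine ⟨(volume (Metric.ball x₀ ε₀)).toNNReal⁻¹ * C, fun f M hf hM => ?_⟩
  -- The constant is a value `f y` at a point where the integral over `Ω` does not exceed its
  -- average over the ball.
  obtain ⟨y, -, hy⟩ := exists_le_setLAverage hv0 hv1
    (f := fun y => ∫⁻ x in Ω, ‖f y - f x‖ₑ)
    (measurable_enorm_sub hf).lintegral_prod_right'.aemeasurable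
  refine ⟨f y, ?_⟩
  have h0 : (volume (Metric.ball x₀ ε₀)).toNNReal ≠ 0 := by
    simp [ENNReal.toNNReal_eq_zero_iff, hv0, hv1]
  rw [ENNReal.coe_mul, ENNReal.coe_inv h0, ENNReal.coe_toNNReal hv1, mul_assoc,
    ← ENNReal.div_eq_inv_mul, ENNReal.le_div_iff_mul_le (Or.inl hv0) (Or.inl hv1)]
  rw [setLAverage_eq, ENNReal.le_div_iff_mul_le (Or.inl hv0) (Or.inl hv1)] at hy
  refine le_trans (le_of_eq ?_) (hy.trans (hC f M hf hM))
  congr 1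
  refine lintegral_congr fun x => ?_
  rw [← enorm_neg, neg_sub]

lemma liminf_le_of_forall_le {u : ℕ → ℝ≥0∞} {a : ℝ≥0∞} (h : ∀ n, u n ≤ a) :
    liminf u atTop ≤ a :=
  (liminf_le_liminf (Eventually.of_forall h)).trans_eq (liminf_const a)

/-! ### Sobolev inequality on lower sets -/

section GridLines

variable {ι : Type*} [Fintype ι] [DecidableEq ι]

/-- The Gagliardo-Nirenberg-Sobolev inequality on a lower set, without boundary condition on the
upper boundary. -/
lemma lintegral_rpow_le_of_isLowerSet_of_contDiff {p : ℝ}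
    (hp : Real.HolderConjugate (Fintype.card ι) p) {W : Set (ι → ℝ)} (hWo : IsOpen W)
    (hW : IsLowerSet W) {g : (ι → ℝ) → ℝ} (hg : ContDiff ℝ 1 g) (hgc : HasCompactSupport g) :
    ∫⁻ x in W, ‖g x‖ₑ ^ p ≤ (∫⁻ x in W, ∑ i, ‖fderiv ℝ g x (Pi.single i 1)‖ₑ) ^ p := by
  set D : (ι → ℝ) → ℝ≥0∞ := W.indicator fun x => ∑ i, ‖fderiv ℝ g x (Pi.single i 1)‖ₑ with hD
  have hfd : Continuous (fderiv ℝ g) := hg.continuous_fderiv one_ne_zero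
  have hDm : Measurable D := by
    refine Measurable.indicator ?_ hWo.measurableSet
    exact (continuous_finsetSum _ fun i _ =>
      (hfd.clm_apply continuous_const).enorm).measurable
  have hcard : (1 : ℝ) < Fintype.card ι := hp.lt
  rw [← lintegral_indicator hWo.measurableSet, ← lintegral_indicator hWo.measurableSet]
  refine le_trans (lintegral_mono fun x => ?_) (lintegral_prod_lintegral_pow_le _ hp hDm)
  by_cases hx : x ∈ W
  · rw [Set.indicator_of_mem hx]
    -- The half-line descending from `x` in direction `i` stays in the lower set, and `g` vanishes
    -- far out on it, so the fundamental theorem of calculus applies without a condition on the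
    -- upper boundary.
    have hline : ∀ i, ‖g x‖ₑ ≤ ∫⁻ t, D (Function.update x i t) := by
      intro i
      have h1 : ‖g x‖ₑ ≤ ∫⁻ t in Set.Iic (x i), ‖deriv (g ∘ Function.update x i) t‖ₑ := by
        apply le_trans (by simp) (HasCompactSupport.enorm_le_lintegral_Ici_deriv _ _ _)
        · exact hg.comp (by convert! contDiff_update 1 x i)
        · exact hgc.comp_isClosedEmbedding (isClosedEmbedding_update x i)
      refine h1.trans ?_
      rw [← lintegral_indicator measurableSet_Iic]
      refine lintegral_mono fun t => ?_
      by_cases ht : t ∈ Set.Iic (x i)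
      · have hmem : Function.update x i t ∈ W := by
          refine hW (fun j => ?_) hx
          rcases eq_or_ne j i with rfl | hj
          · simpa using ht
          · simp [hj]
        rw [Set.indicator_of_mem ht, hD, Set.indicator_of_mem hmem,
          fderiv_comp_deriv _ (hg.differentiable one_ne_zero).differentiableAt
          (hasDerivAt_update x i t).differentiableAt, deriv_update]
        exact Finset.single_le_sum
          (f := fun j => ‖fderiv ℝ g (Function.update x i t) (Pi.single j 1)‖ₑ)
          (fun _ _ => zero_le) (Finset.mem_univ i)
      · rw [Set.indicator_of_notMem ht]
        exact zero_le
    calc ‖g x‖ₑ ^ p = ∏ _i : ι, ‖g x‖ₑ ^ (1 / (Fintype.card ι - 1 : ℝ)) := by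
          have h0 : (Fintype.card ι - 1 : ℝ) ≠ 0 := by linarith
          rw [Finset.prod_const, ← ENNReal.rpow_natCast, ← ENNReal.rpow_mul, hp.conjugate_eq,
            Finset.card_univ]
          congr 1
          field_simp
      _ ≤ _ := by
          refine Finset.prod_le_prod' fun i _ => ?_
          have h0 : (0 : ℝ) ≤ 1 / (Fintype.card ι - 1 : ℝ) :=
            one_div_nonneg.2 (by linarith)
          exact ENNReal.rpow_le_rpow (hline i) h0
  · rw [Set.indicator_of_notMem hx]
    exact zero_le

/-- Mollification does not increase the directional derivatives of a function on a lower set. -/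
lemma lintegral_enorm_fderiv_convolution_le {U : Set (ι → ℝ)} (hUo : IsOpen U)
    (hU : IsLowerSet U) {F : (ι → ℝ) → ℝ} (hFm : Measurable F) (hF : Integrable F)
    (φ : ContDiffBump (0 : ι → ℝ)) {M : ℝ≥0∞} {i : ι} {t₀ : ℝ} (ht₀ : 0 < t₀)
    (hM : ∀ t ∈ Set.Ioo 0 t₀,
      ∫⁻ y in U, ‖F y - F (y - t • Pi.single i 1)‖ₑ ≤ ENNReal.ofReal t * M) :
    ∫⁻ x in {x | x + (fun _ => φ.rOut) ∈ U},
      ‖fderiv ℝ (convolution (φ.normed volume) F (ContinuousLinearMap.lsmul ℝ ℝ) volume) x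
        (Pi.single i 1)‖ₑ ≤ M := by
  -- Moving a point of `W` by a vector of sup norm less than `rOut` leaves it in the lower set `U`,
  -- so mollifying on `W` uses only the bound on `U`.
  set W : Set (ι → ℝ) := {x | x + (fun _ => φ.rOut) ∈ U} with hWdef
  have hWo : IsOpen W := hUo.preimage (continuous_id.add continuous_const)
  set ρ := φ.normed (volume : Measure (ι → ℝ)) with hρ
  set g := convolution ρ F (ContinuousLinearMap.lsmul ℝ ℝ) volume with hg
  have hgd : ContDiff ℝ 1 g :=
    φ.hasCompactSupport_normed.contDiff_convolution_left _ φ.contDiff_normed hF.locallyIntegrable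
  have hex : ∀ x, Integrable fun t => ρ t * F (x - t) := fun x =>
    ((φ.hasCompactSupport_normed (μ := volume)).convolutionExists_left
      (ContinuousLinearMap.lsmul ℝ ℝ) φ.continuous_normed hF.locallyIntegrable x).integrable
  have hgx : ∀ x, g x = ∫ t, ρ t * F (x - t) := fun x => rfl
  have hρ1 : ∫⁻ t, ‖ρ t‖ₑ = 1 := by
    rw [← ofReal_integral_norm_eq_lintegral_enorm φ.integrable_normed]
    simp only [Real.norm_of_nonneg (φ.nonneg_normed _), φ.integral_normed, ENNReal.ofReal_one]
  have hρm : Measurable ρ := φ.continuous_normed.measurable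
  have hdiff : ∀ t ∈ Set.Ioo 0 t₀,
      ∫⁻ x in W, ‖g (x + t • (-Pi.single i 1)) - g x‖ₑ ≤ ENNReal.ofReal t * M := by
    intro t ht
    set H : (ι → ℝ) → ℝ≥0∞ := fun y => ‖F y - F (y - t • Pi.single i 1)‖ₑ with hH
    have hHm : Measurable H := (hFm.sub (hFm.comp (measurable_id.sub_const _))).enorm
    have hpt : ∀ x, ‖g (x + t • (-Pi.single i 1)) - g x‖ₑ ≤ ∫⁻ z, ‖ρ z‖ₑ * H (x - z) := by
      intro x
      rw [hgx, hgx, ← integral_sub (hex _) (hex _)]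
      refine (enorm_integral_le_lintegral_enorm _).trans (lintegral_mono fun z => ?_)
      rw [← mul_sub, enorm_mul, ← enorm_neg (F _ - F _), neg_sub]
      have : x + t • (-Pi.single i 1) - z = x - z - t • (Pi.single i 1 : ι → ℝ) := by module
      rw [this]
    refine (lintegral_mono hpt).trans ?_
    rw [lintegral_lintegral_swap]
    swap
    · refine Measurable.aemeasurable ?_
      exact (hρm.enorm.comp measurable_snd).mul (hHm.comp (measurable_fst.sub measurable_snd))
    have hz : ∀ z, ∫⁻ x in W, ‖ρ z‖ₑ * H (x - z) ≤ ‖ρ z‖ₑ * (ENNReal.ofReal t * M) := by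
      intro z
      by_cases hz0 : ρ z = 0
      · simp [hz0]
      rw [lintegral_const_mul' _ _ enorm_ne_top]
      refine mul_le_mul_right (le_trans ?_ (hM t ht)) _
      have hzr : ‖z‖ < φ.rOut := by
        have : z ∈ Function.support ρ := hz0
        rwa [hρ, φ.support_normed_eq, mem_ball_zero_iff] at this
      rw [← lintegral_indicator hWo.measurableSet, ← lintegral_indicator hUo.measurableSet,
        ← lintegral_add_right_eq_self _ z]
      refine lintegral_mono fun x => ?_
      by_cases hx : x + z ∈ W
      · have hxU : x ∈ U := by
          refine hU (fun j => ?_) hx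
          have := (abs_le.1 ((norm_le_pi_norm z j).trans hzr.le)).1
          simp only [Pi.add_apply]
          linarith
        rw [Set.indicator_of_mem hx, Set.indicator_of_mem hxU, add_sub_cancel_right]
      · rw [Set.indicator_of_notMem hx]
        exact zero_le
    refine (lintegral_mono hz).trans_eq ?_
    rw [lintegral_mul_const _ hρm.enorm, hρ1, one_mul]
  -- The step lengths are `1 / c n`; the shift by `2` keeps the first one strictly below `t₀`.
  set c : ℕ → ℝ := fun n => (n + 2) / t₀ with hc
  have hcpos : ∀ n, 0 < c n := fun n => by positivity
  have hcinv : ∀ n, (c n)⁻¹ ∈ Set.Ioo 0 t₀ := by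
    intro n
    refine ⟨inv_pos.2 (hcpos n), ?_⟩
    rw [hc, inv_div, div_lt_iff₀ (by positivity)]
    have : (0 : ℝ) ≤ n := by positivity
    nlinarith
  have hctop : Tendsto (fun n => ‖c n‖) atTop atTop := by
    simp only [Real.norm_of_nonneg (hcpos _).le]
    exact (tendsto_atTop_add_const_right _ _ tendsto_natCast_atTop_atTop).atTop_div_const ht₀
  have hlim : ∀ x, Tendsto
      (fun n => ‖c n • (g (x + (c n)⁻¹ • (-Pi.single i 1)) - g x)‖ₑ) atTop
      (𝓝 ‖fderiv ℝ g x (Pi.single i 1)‖ₑ) := by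
    intro x
    have := ((hgd.differentiable one_ne_zero x).hasFDerivAt.lim (-Pi.single i 1) hctop).enorm
    rwa [map_neg, enorm_neg] at this
  -- Fatou's lemma carries the uniform bound on difference quotients to the derivative.
  calc ∫⁻ x in W, ‖fderiv ℝ g x (Pi.single i 1)‖ₑ
      = ∫⁻ x in W, liminf
          (fun n => ‖c n • (g (x + (c n)⁻¹ • (-Pi.single i 1)) - g x)‖ₑ) atTop :=
        lintegral_congr fun x => (hlim x).liminf_eq.symm
    _ ≤ liminf (fun n => ∫⁻ x in W,
          ‖c n • (g (x + (c n)⁻¹ • (-Pi.single i 1)) - g x)‖ₑ) atTop := by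
        refine lintegral_liminf_le fun n => ?_
        have := hgd.continuous
        fun_prop
    _ ≤ M := by
        refine liminf_le_of_forall_le fun n => ?_
        simp only [enorm_smul]
        rw [lintegral_const_mul' _ _ enorm_ne_top]
        refine (mul_le_mul_right (hdiff _ (hcinv n)) _).trans_eq ?_
        rw [← mul_assoc, Real.enorm_of_nonneg (hcpos n).le,
            ← ENNReal.ofReal_mul (hcpos n).le, mul_inv_cancel₀ (hcpos n).ne',
            ENNReal.ofReal_one, one_mul]

/-- The Sobolev inequality on an open lower set for functions with bounded difference quotients. -/
theorem lintegral_rpow_le_of_isLowerSet {p : ℝ}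
    (hp : Real.HolderConjugate (Fintype.card ι) p) {U : Set (ι → ℝ)} (hUo : IsOpen U)
    (hU : IsLowerSet U) {F : (ι → ℝ) → ℝ} (hFm : Measurable F) (hF : Integrable F)
    (hFc : HasCompactSupport F) {M : ℝ≥0∞}
    (hM : ∀ i, ∃ t₀ > 0, ∀ t ∈ Set.Ioo 0 t₀,
      ∫⁻ y in U, ‖F y - F (y - t • Pi.single i 1)‖ₑ ≤ ENNReal.ofReal t * M) :
    ∫⁻ x in U, ‖F x‖ₑ ^ p ≤ (Fintype.card ι * M) ^ p := by
  have hp0 : 0 ≤ p := hp.symm.nonneg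
  set φ : ℕ → ContDiffBump (0 : ι → ℝ) := shrinkingBump 1 one_pos
  set g : ℕ → (ι → ℝ) → ℝ := fun n =>
    convolution ((φ n).normed volume) F (ContinuousLinearMap.lsmul ℝ ℝ) volume
  set W : ℕ → Set (ι → ℝ) := fun n => {x | x + (fun _ => (φ n).rOut) ∈ U}
  have hWo : ∀ n, IsOpen (W n) := fun n => hUo.preimage (continuous_id.add continuous_const)
  have hWl : ∀ n, IsLowerSet (W n) := fun n a b hab ha => hU (add_le_add_left hab _) ha
  have hgd : ∀ n, ContDiff ℝ 1 (g n) := fun n =>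
    (φ n).hasCompactSupport_normed.contDiff_convolution_left _ (φ n).contDiff_normed
      hF.locallyIntegrable
  have hgc : ∀ n, HasCompactSupport (g n) := fun n =>
    HasCompactSupport.convolution _ (φ n).hasCompactSupport_normed hFc
  have hbound : ∀ n, ∫⁻ x in W n, ‖g n x‖ₑ ^ p ≤ (Fintype.card ι * M) ^ p := by
    intro n
    refine (lintegral_rpow_le_of_isLowerSet_of_contDiff hp (hWo n) (hWl n) (hgd n)
      (hgc n)).trans (ENNReal.rpow_le_rpow ?_ hp0)
    rw [lintegral_finsetSum]
    · refine (Finset.sum_le_card_nsmul _ _ M fun i _ => ?_).trans_eq (by simp)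
      obtain ⟨t₀, ht₀, h⟩ := hM i
      exact lintegral_enorm_fderiv_convolution_le hUo hU hFm hF (φ n) ht₀ h
    · exact fun i _ => (((hgd n).continuous_fderiv one_ne_zero).clm_apply
        continuous_const).enorm.measurable
  -- Since `U` is open, each of its points eventually lies in `W n`; with almost everywhere
  -- convergence of the mollifications this prepares Fatou's lemma.
  have hae : ∀ᵐ x, U.indicator (fun x => ‖F x‖ₑ ^ p) x ≤
      liminf (fun n => (W n).indicator (fun x => ‖g n x‖ₑ ^ p) x) atTop := by
    filter_upwards [ContDiffBump.ae_convolution_tendsto_right_of_locallyIntegrable (K := 2)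
      (φ := φ) (tendsto_rOut_shrinkingBump one_pos)
      (Eventually.of_forall (rOut_shrinkingBump_le_mul one_pos)) hF.locallyIntegrable] with x hx
    by_cases hxU : x ∈ U
    · rw [Set.indicator_of_mem hxU]
      have hW : ∀ᶠ n in atTop, x ∈ W n := by
        have : Tendsto (fun n => x + (fun _ : ι => (φ n).rOut)) atTop (𝓝 (x + fun _ => 0)) :=
          tendsto_const_nhds.add
            (tendsto_pi_nhds.2 fun _ => tendsto_rOut_shrinkingBump one_pos)
        refine this.eventually_mem (hUo.mem_nhds ?_)
        convert! hxU
        exact add_zero x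
      have hlim : Tendsto (fun n => (W n).indicator (fun x => ‖g n x‖ₑ ^ p) x) atTop
          (𝓝 (‖F x‖ₑ ^ p)) := by
        refine Tendsto.congr' ?_ ((ENNReal.continuous_rpow_const.tendsto _).comp hx.enorm)
        filter_upwards [hW] with n hn
        rw [Set.indicator_of_mem hn]
        rfl
      exact hlim.liminf_eq.ge
    · rw [Set.indicator_of_notMem hxU]
      exact zero_le
  rw [← lintegral_indicator hUo.measurableSet]
  refine (lintegral_mono_ae hae).trans ((lintegral_liminf_le fun n => ?_).trans
    (liminf_le_of_forall_le fun n => ?_))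
  · exact ((hgd n).continuous.measurable.enorm.pow_const p).indicator (hWo n).measurableSet
  · rw [lintegral_indicator (hWo n).measurableSet]
    exact hbound n

end GridLines

/-! ### The critical exponent -/

section Exponent

variable [hd : Fact (2 ≤ d)]

lemma toReal_critExp : (critExp d).toReal = (d : ℝ) / (d - 1) := by
  have h2 : ((d : ℝ≥0∞) - 1) = ((d - 1 : ℕ) : ℝ≥0∞) := by simp
  rw [critExp, h2, ENNReal.toReal_div, ENNReal.toReal_natCast, ENNReal.toReal_natCast,
    Nat.cast_sub (by have := hd.out; omega), Nat.cast_one]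

lemma holderConjugate_toReal_critExp : Real.HolderConjugate d (critExp d).toReal := by
  have : (1 : ℝ) < d := by exact_mod_cast hd.out
  rw [toReal_critExp]
  exact Real.HolderConjugate.conjExponent this

lemma critExp_ne_top : critExp d ≠ ∞ := by
  intro h
  have := (holderConjugate_toReal_critExp (d := d)).symm.pos
  simp [h] at this

lemma critExp_ne_zero : critExp d ≠ 0 :=
  (lt_of_lt_of_le one_pos (fact_one_le_critExp d).out).ne'

end Exponent

/-! ### Local Sobolev inequality at a point with an inner cone -/

lemma sub_sum_smul_mem {ι : Type*} {U : Set (E d)} {v : ι → E d}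
    (hU : ∀ y ∈ U, ∀ i, ∀ s : ℝ, 0 ≤ s → y - s • v i ∈ U) (t : Finset ι) {c : ι → ℝ}
    (hc : ∀ i, 0 ≤ c i) {y : E d} (hy : y ∈ U) : y - ∑ i ∈ t, c i • v i ∈ U := by
  classical
  induction t using Finset.induction_on with
  | empty => simpa using hy
  | insert i t hi ih =>
    rw [Finset.sum_insert hi, add_comm, ← sub_sub]
    exact hU _ ih i _ (hc i)

/-- The Sobolev inequality on an open set that is stable under translations by the negatives of
the vectors of a basis. -/
theorem exists_sobolev_of_basis {p : ℝ} (hp : Real.HolderConjugate d p) {ι : Type*} [Fintype ι]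
    (b : Module.Basis ι ℝ (E d)) {U : Set (E d)} (hUo : IsOpen U)
    (hU : ∀ y ∈ U, ∀ i, ∀ s : ℝ, 0 ≤ s → y - s • b i ∈ U) :
    ∃ C : ℝ≥0, ∀ (F : E d → ℝ) (M : ℝ≥0∞), Measurable F → Integrable F → HasCompactSupport F →
      (∀ i, ∃ t₀ > 0, ∀ t ∈ Set.Ioo 0 t₀,
        ∫⁻ y in U, ‖F y - F (y - t • b i)‖ₑ ≤ ENNReal.ofReal t * M) →
      (∫⁻ x in U, ‖F x‖ₑ ^ p) ^ (1 / p) ≤ C * M := by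
  classical
  have hcard : Fintype.card ι = d := by
    rw [← Module.finrank_eq_card_basis b, finrank_euclideanSpace_fin]
  have hp0 : 0 < p := hp.symm.pos
  set e : E d ≃L[ℝ] (ι → ℝ) := b.equivFunL with he
  -- By uniqueness of Haar measure, coordinates in the basis `b` change Lebesgue measure only by a
  -- constant factor.
  set c : ℝ≥0 := Measure.addHaarScalarFactor (volume : Measure (E d))
    ((volume : Measure (ι → ℝ)).map e.symm) with hcdef
  have hc0 : c ≠ 0 := (Measure.addHaarScalarFactor_pos_of_isAddHaarMeasure _ _).ne'
  have hvol : (volume : Measure (E d)) = c • (volume : Measure (ι → ℝ)).map e.symm :=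
    Measure.isAddLeftInvariant_eq_smul ..
  have hem : Measurable e.symm := e.symm.continuous.measurable
  have hset : ∀ G : E d → ℝ≥0∞, Measurable G →
      ∫⁻ y in U, G y = c * ∫⁻ x in e.symm ⁻¹' U, G (e.symm x) := by
    intro G hG
    rw [hvol, Measure.restrict_smul, lintegral_smul_measure,
      setLIntegral_map hUo.measurableSet hG hem]
    rfl
  have hcne : (c : ℝ≥0∞) ≠ 0 := by simpa using hc0
  refine ⟨c ^ (1 / p) * (d * c⁻¹), fun F M hFm hF hFc hM => ?_⟩
  have hsingle : ∀ i, e.symm (Pi.single i 1) = b i := by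
    intro i
    rw [e.symm_apply_eq]
    ext j
    simp [he, Module.Basis.equivFunL, Pi.single_apply, eq_comm]
  have hlow : IsLowerSet (e.symm ⁻¹' U) := by
    intro x y hyx hx
    have h := sub_sum_smul_mem hU Finset.univ (c := x - y) (fun i => sub_nonneg.2 (hyx i)) hx
    have h2 : e.symm (x - y) = ∑ i, (x - y) i • b i := by
      have := b.equivFun_symm_apply (x - y)
      exact this
    rw [← h2, ← map_sub, sub_sub_cancel] at h
    exact h
  have hFi : Integrable (fun x => F (e.symm x)) := by
    have h1 : Integrable F (c • (volume : Measure (ι → ℝ)).map e.symm) := hvol ▸ hF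
    have h2 : Integrable F ((volume : Measure (ι → ℝ)).map e.symm) :=
      (integrable_smul_measure hcne ENNReal.coe_ne_top).1 h1
    exact (integrable_map_measure hFm.aestronglyMeasurable hem.aemeasurable).1 h2
  have key := lintegral_rpow_le_of_isLowerSet (by rwa [hcard] : Real.HolderConjugate
    (Fintype.card ι) p) (hUo.preimage e.symm.continuous) hlow (hFm.comp hem) hFi
    (hFc.comp_homeomorph e.symm.toHomeomorph) (M := (c : ℝ≥0∞)⁻¹ * M) ?_
  · rw [hset _ (hFm.enorm.pow_const p), ENNReal.mul_rpow_of_nonneg _ _ (by positivity)]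
    have h3 : (∫⁻ x in e.symm ⁻¹' U, ‖F (e.symm x)‖ₑ ^ p) ^ (1 / p) ≤ d * ((c : ℝ≥0∞)⁻¹ * M) := by
      refine (ENNReal.rpow_le_rpow key (by positivity)).trans_eq ?_
      rw [← ENNReal.rpow_mul, mul_one_div_cancel hp0.ne', ENNReal.rpow_one, hcard]
    refine (mul_le_mul_right h3 _).trans_eq ?_
    rw [ENNReal.coe_mul, ENNReal.coe_mul, ENNReal.coe_inv hc0,
      ENNReal.coe_rpow_of_nonneg _ (by positivity), ENNReal.coe_natCast]
    ring
  · intro i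
    obtain ⟨t₀, ht₀, h⟩ := hM i
    refine ⟨t₀, ht₀, fun t ht => ?_⟩
    have h1 := h t ht
    rw [hset (fun y => ‖F y - F (y - t • b i)‖ₑ)
      (hFm.sub (hFm.comp (measurable_id.sub_const _))).enorm] at h1
    rw [mul_left_comm, ← ENNReal.div_eq_inv_mul,
      ENNReal.le_div_iff_mul_le (Or.inl hcne) (Or.inl ENNReal.coe_ne_top), mul_comm]
    simpa only [Function.comp_apply, map_sub, map_smul, hsingle] using h1

/-- An open ball spans the space, so a basis can be extracted from it; this supplies coordinate
directions inside the cone. -/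
lemma exists_basis_mem_ball (e : E d) {δ : ℝ} (hδ : 0 < δ) :
    ∃ (t : Finset (E d)) (b : Module.Basis t ℝ (E d)), ∀ i, b i ∈ Metric.ball e δ := by
  obtain ⟨t, hts, -, hspan, hli⟩ :=
    Submodule.exists_finset_span_eq_linearIndepOn ℝ (Metric.ball e δ)
  have htop : Submodule.span ℝ (Metric.ball e δ) = ⊤ := by
    refine Submodule.eq_top_of_nonempty_interior' _ ⟨e, ?_⟩
    exact mem_interior.2 ⟨_, Submodule.subset_span, Metric.isOpen_ball, Metric.mem_ball_self hδ⟩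
  have hli' : LinearIndependent ℝ (fun i : t => (i : E d)) := hli
  refine ⟨t, Module.Basis.mk hli' ?_, fun i => ?_⟩
  · have : Set.range (fun i : t => (i : E d)) = t := by simp
    rw [this, hspan, htop]
  · rw [Module.Basis.mk_apply]
    exact hts i.2

/-- The Lipschitz cutoff function `y ↦ max 0 (1 - |y - x| / r)`. -/
noncomputable def cutoff (x : E d) (r : ℝ) (y : E d) : ℝ := max 0 (1 - dist y x / r)

lemma cutoff_nonneg (x : E d) (r : ℝ) (y : E d) : 0 ≤ cutoff x r y := le_max_left _ _

lemma cutoff_le_one (x : E d) {r : ℝ} (hr : 0 < r) (y : E d) : cutoff x r y ≤ 1 :=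
  max_le zero_le_one (sub_le_self _ (by positivity))

lemma cutoff_eq_zero {x : E d} {r : ℝ} (hr : 0 < r) {y : E d} (h : r ≤ dist y x) :
    cutoff x r y = 0 :=
  max_eq_left (sub_nonpos.2 ((one_le_div hr).2 h))

lemma half_le_cutoff {x : E d} {r : ℝ} (hr : 0 < r) {y : E d} (h : dist y x ≤ r / 2) :
    1 / 2 ≤ cutoff x r y := by
  refine le_trans ?_ (le_max_right _ _)
  have : dist y x / r ≤ 1 / 2 := by rw [div_le_iff₀ hr]; linarith
  linarith

lemma continuous_cutoff (x : E d) (r : ℝ) : Continuous (cutoff x r) := by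
  unfold cutoff; fun_prop

lemma abs_cutoff_sub_le (x : E d) {r : ℝ} (hr : 0 < r) (y z : E d) :
    |cutoff x r y - cutoff x r z| ≤ ‖y - z‖ / r := by
  unfold cutoff
  refine (abs_max_sub_max_le_max _ _ _ _).trans ?_
  rw [sub_self, abs_zero, max_eq_right (abs_nonneg _),
    show 1 - dist y x / r - (1 - dist z x / r) = (dist z x - dist y x) / r by ring, abs_div,
    abs_of_pos hr]
  gcongr
  rw [← dist_eq_norm, dist_comm y z]
  exact abs_dist_sub_le z y x

/-- The Sobolev inequality near a point at which `Ω` has an inner cone. -/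
theorem HasInnerCone.exists_local_sobolev [Fact (2 ≤ d)] {Ω : Set (E d)} (hΩ : IsOpen Ω)
    {x : E d} (h : HasInnerCone Ω x) :
    ∃ (r : ℝ) (C : ℝ≥0), 0 < r ∧ ∀ (f : E d → ℝ) (M : ℝ≥0), Measurable f → IntegrableOn f Ω →
      TransBound Ω f M →
      eLpNorm f (critExp d) (volume.restrict (Ω ∩ Metric.ball x r)) ≤
        C * (M + ∫⁻ y in Ω, ‖f y‖ₑ) := by
  obtain ⟨e, δ, r₀, U, hδ, hr₀, hUo, hUΩ, hcone⟩ := h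
  obtain ⟨t, b, hb⟩ := exists_basis_mem_ball e hδ
  have hUb : ∀ y ∈ U, ∀ i, ∀ s : ℝ, 0 ≤ s → y - s • b i ∈ U := fun y hy i s hs =>
    hcone y hy _ (hb i) s hs
  obtain ⟨C, hC⟩ := exists_sobolev_of_basis holderConjugate_toReal_critExp b hUo hUb
  set r : ℝ := r₀ / 2 with hr
  have hrpos : 0 < r := by positivity
  set B : ℝ := ‖e‖ + δ with hB
  have hBpos : 0 < B := by positivity
  have hbB : ∀ i, ‖b i‖ ≤ B := by
    intro i
    have h1 : ‖b i - e‖ < δ := by simpa [dist_eq_norm] using hb i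
    have h2 := norm_add_le (b i - e) e
    rw [sub_add_cancel] at h2
    linarith
  refine ⟨r / 2, 2 * (C * (B.toNNReal * (1 + r⁻¹.toNNReal))), by positivity,
    fun f M hfm hf hM => ?_⟩
  have hUmem : ∀ y ∈ Metric.ball x r₀, (y ∈ U ↔ y ∈ Ω) := by
    intro y hy
    have : y ∈ U ∩ Metric.ball x r₀ ↔ y ∈ Ω ∩ Metric.ball x r₀ := by rw [hUΩ]
    simpa [hy] using this
  set f₀ : E d → ℝ := Ω.indicator f with hf₀
  have hf₀m : Measurable f₀ := hfm.indicator hΩ.measurableSet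
  have hf₀i : Integrable f₀ := (integrable_indicator_iff hΩ.measurableSet).2 hf
  set η : E d → ℝ := cutoff x r with hη
  set F : E d → ℝ := fun y => η y * f₀ y with hF
  have hFm : Measurable F := (continuous_cutoff x r).measurable.mul hf₀m
  have hηb : ∀ y, ‖η y‖ ≤ 1 := fun y => by
    rw [Real.norm_of_nonneg (cutoff_nonneg x r y)]; exact cutoff_le_one x hrpos y
  have hFi : Integrable F := hf₀i.bdd_mul (c := 1)
    (continuous_cutoff x r).aestronglyMeasurable (Eventually.of_forall hηb)
  have hFc : HasCompactSupport F := by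
    refine HasCompactSupport.intro (isCompact_closedBall x r) fun y hy => ?_
    have : η y = 0 := cutoff_eq_zero hrpos (le_of_lt (by simpa using hy))
    simp [hF, this]
  -- The cutoff vanishes beyond `r₀ / 2` and shifts are at most `r₀ / 4`. From `A` one therefore
  -- stays in the ball where `U` and `Ω` agree, while for `y ∈ U` outside `A` both `y` and its shift
  -- lie where the cutoff is zero.
  set A : Set (E d) := Ω ∩ Metric.ball x (3 * r₀ / 4) with hA
  have hAo : IsOpen A := hΩ.inter Metric.isOpen_ball
  have hbound := hC F (B.toNNReal * (M + r⁻¹.toNNReal * ∫⁻ y in Ω, ‖f y‖ₑ)) hFm hFi hFc ?_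
  · have hle : eLpNorm f (critExp d) (volume.restrict (Ω ∩ Metric.ball x (r / 2))) ≤
        (2 : ℝ≥0) * eLpNorm F (critExp d) (volume.restrict U) := by
      refine le_trans (eLpNorm_le_mul_eLpNorm_of_ae_le_mul' (c := 2) (g := F) ?_ _) ?_
      · refine ae_restrict_of_forall_mem
          (hΩ.inter Metric.isOpen_ball).measurableSet fun y hy => ?_
        have h1 : 1 / 2 ≤ η y := half_le_cutoff hrpos (le_of_lt hy.2)
        have h2 : F y = η y * f y := by simp [hF, hf₀, hy.1]
        rw [h2, ← ofReal_norm, ← ofReal_norm, norm_mul]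
        have h3 : ((2 : ℝ≥0) : ℝ≥0∞) = ENNReal.ofReal 2 := by simp
        rw [h3, ← ENNReal.ofReal_mul zero_le_two]
        refine ENNReal.ofReal_le_ofReal ?_
        have h4 : 1 / 2 ≤ ‖η y‖ := h1.trans (le_abs_self _)
        nlinarith [norm_nonneg (f y)]
      · refine mul_le_mul_right (eLpNorm_mono_measure _ (Measure.restrict_mono ?_ le_rfl)) _
        intro y hy
        refine (hUmem y ?_).2 hy.1
        exact Metric.ball_subset_ball (by linarith) hy.2
    refine hle.trans ?_
    rw [eLpNorm_eq_lintegral_rpow_enorm_toReal critExp_ne_zero critExp_ne_top]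
    refine (mul_le_mul_right hbound _).trans ?_
    push_cast
    rw [mul_assoc, mul_assoc, mul_assoc]
    gcongr
    rw [add_mul, one_mul]
    gcongr
    · exact le_self_add
    · exact le_add_self
  · intro i
    have hbi : 0 < ‖b i‖ + 1 := by positivity
    refine ⟨r₀ / (4 * (‖b i‖ + 1)), by positivity, fun s hs => ?_⟩
    have hs0 : 0 ≤ s := hs.1.le
    have hsb : ‖s • b i‖ ≤ r₀ / 4 := by
      rw [norm_smul, Real.norm_of_nonneg hs0]
      have := hs.2.le
      rw [le_div_iff₀ (by positivity)] at this
      nlinarith [norm_nonneg (b i)]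
    have hshift : ∀ y, dist (y - s • b i) y ≤ r₀ / 4 := fun y => by
      simpa [dist_eq_norm] using hsb
    have hAΩ : ∀ y ∈ A, ∀ τ ∈ Set.Icc (0 : ℝ) 1, y - τ • (s • b i) ∈ Ω := by
      intro y hy τ hτ
      have hyr : y ∈ Metric.ball x r₀ := Metric.ball_subset_ball (by linarith) hy.2
      have h1 : y - τ • (s • b i) ∈ U := by
        rw [smul_smul]
        exact hUb y ((hUmem y hyr).2 hy.1) i _ (mul_nonneg hτ.1 hs0)
      refine (hUmem _ ?_).1 h1
      have h2 : dist (y - τ • (s • b i)) y ≤ r₀ / 4 := by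
        rw [dist_eq_norm, sub_sub_cancel_left, norm_neg, norm_smul, Real.norm_of_nonneg hτ.1]
        exact (mul_le_of_le_one_left (norm_nonneg _) hτ.2).trans hsb
      have h3 := Metric.mem_ball.1 hy.2
      have h4 := dist_triangle (y - τ • (s • b i)) y x
      rw [Metric.mem_ball]
      linarith
    set k : ℝ≥0∞ := ENNReal.ofReal (‖s • b i‖ / r) with hk
    -- A discrete product rule: the second term uses that the cutoff is `1 / r`-Lipschitz.
    have hpt : ∀ y ∈ U, ‖F y - F (y - s • b i)‖ₑ ≤
        A.indicator (fun y => ‖f y - f (y - s • b i)‖ₑ) y + k * ‖f₀ (y - s • b i)‖ₑ := by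
      intro y hy
      by_cases hyA : y ∈ A
      · rw [Set.indicator_of_mem hyA]
        have h1 : f₀ y = f y := Set.indicator_of_mem hyA.1 _
        have h2 : f₀ (y - s • b i) = f (y - s • b i) := by
          refine Set.indicator_of_mem ?_ _
          simpa using hAΩ y hyA 1 ⟨zero_le_one, le_rfl⟩
        have h3 : F y - F (y - s • b i) = η y * (f y - f (y - s • b i)) +
            (η y - η (y - s • b i)) * f₀ (y - s • b i) := by
          simp only [hF, h1, h2]; ring
        rw [h3]
        refine (enorm_add_le _ _).trans (add_le_add ?_ ?_)
        · rw [enorm_mul]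
          refine mul_le_of_le_one_left' ?_
          rw [← ofReal_norm, ← ENNReal.ofReal_one]
          exact ENNReal.ofReal_le_ofReal (hηb y)
        · rw [enorm_mul]
          refine mul_le_mul_left ?_ _
          rw [← ofReal_norm, hk]
          refine ENNReal.ofReal_le_ofReal ?_
          simpa using abs_cutoff_sub_le x hrpos y (y - s • b i)
      · have h1 : F y = 0 ∧ F (y - s • b i) = 0 := by
          have hfar : 3 * r₀ / 4 ≤ dist y x := by
            by_contra hlt
            rw [not_le] at hlt
            exact hyA ⟨(hUmem y (Metric.mem_ball.2 (by linarith))).1 hy, hlt⟩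
          have h2 := dist_triangle y (y - s • b i) x
          have h3 := hshift y
          rw [dist_comm] at h3
          have h4 : η y = 0 := cutoff_eq_zero hrpos (by linarith)
          have h5 : η (y - s • b i) = 0 := cutoff_eq_zero hrpos (by linarith)
          simp [hF, h4, h5]
        simp [h1.1, h1.2]
    calc ∫⁻ y in U, ‖F y - F (y - s • b i)‖ₑ
        ≤ ∫⁻ y in U, (A.indicator (fun y => ‖f y - f (y - s • b i)‖ₑ) y +
            k * ‖f₀ (y - s • b i)‖ₑ) := setLIntegral_mono' hUo.measurableSet hpt
      _ ≤ ∫⁻ y, (A.indicator (fun y => ‖f y - f (y - s • b i)‖ₑ) y +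
            k * ‖f₀ (y - s • b i)‖ₑ) := setLIntegral_le_lintegral _ _
      _ = (∫⁻ y in A, ‖f y - f (y - s • b i)‖ₑ) + k * ∫⁻ y in Ω, ‖f y‖ₑ := by
          rw [lintegral_add_left, lintegral_indicator hAo.measurableSet,
            lintegral_const_mul' _ _ ENNReal.ofReal_ne_top,
            lintegral_sub_right_eq_self (fun y => ‖f₀ y‖ₑ)]
          · simp only [hf₀, enorm_indicator_eq_indicator_enorm]
            rw [lintegral_indicator hΩ.measurableSet]
          · exact (hfm.sub (hfm.comp (measurable_id.sub_const _))).enorm.indicator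
              hAo.measurableSet
      _ ≤ ‖s • b i‖ₑ * M + k * ∫⁻ y in Ω, ‖f y‖ₑ := by
          gcongr
          exact hM A _ hAo hAΩ
      _ = ‖s • b i‖ₑ * (M + r⁻¹.toNNReal * ∫⁻ y in Ω, ‖f y‖ₑ) := by
          rw [hk, div_eq_mul_inv, ENNReal.ofReal_mul (norm_nonneg _), ofReal_norm, ENNReal.ofReal]
          ring
      _ ≤ _ := by
          rw [← mul_assoc]
          gcongr
          rw [enorm_smul, Real.enorm_of_nonneg hs0]
          gcongr
          rw [← ofReal_norm]
          exact ENNReal.ofReal_le_ofReal (hbB i)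

/-! ### Global Sobolev and Poincaré-Sobolev inequalities -/

/-- The power `t ↦ t ^ (1 / p)` is subadditive for `p ≥ 1`. -/
lemma eLpNorm_restrict_union_le {p : ℝ≥0∞} (hp1 : 1 ≤ p) (hp : p ≠ ∞) {f : E d → ℝ}
    (s t : Set (E d)) :
    eLpNorm f p (volume.restrict (s ∪ t)) ≤
      eLpNorm f p (volume.restrict s) + eLpNorm f p (volume.restrict t) := by
  have hp0 : p ≠ 0 := (one_pos.trans_le hp1).ne'
  have hpr : 1 ≤ p.toReal := by
    rw [← ENNReal.toReal_one]; exact ENNReal.toReal_mono hp hp1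
  simp only [eLpNorm_eq_lintegral_rpow_enorm_toReal hp0 hp]
  refine (ENNReal.rpow_le_rpow (lintegral_union_le _ _ _) (by positivity)).trans ?_
  exact ENNReal.rpow_add_le_add_rpow _ _ (by positivity) ((div_le_one (by linarith)).2 hpr)

/-- The Sobolev inequality on a bounded Lipschitz domain. -/
theorem IsBoundedLipschitzDomain.exists_sobolev [Fact (2 ≤ d)] {Ω : Set (E d)}
    (hΩ : IsBoundedLipschitzDomain Ω) :
    ∃ C : ℝ≥0, ∀ (f : E d → ℝ) (M : ℝ≥0), Measurable f → IntegrableOn f Ω → TransBound Ω f M →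
      eLpNorm f (critExp d) (volume.restrict Ω) ≤ C * (M + ∫⁻ y in Ω, ‖f y‖ₑ) := by
  have h : ∃ C : ℝ≥0, ∀ (f : E d → ℝ) (M : ℝ≥0), Measurable f → IntegrableOn f Ω →
      TransBound Ω f M → eLpNorm f (critExp d) (volume.restrict (Ω ∩ closure Ω)) ≤
        C * (M + ∫⁻ y in Ω, ‖f y‖ₑ) := by
    refine hΩ.isBounded.isCompact_closure.induction_on
      (p := fun s => ∃ C : ℝ≥0, ∀ (f : E d → ℝ) (M : ℝ≥0), Measurable f → IntegrableOn f Ω →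
      TransBound Ω f M → eLpNorm f (critExp d) (volume.restrict (Ω ∩ s)) ≤
        C * (M + ∫⁻ y in Ω, ‖f y‖ₑ)) ⟨0, by simp⟩ ?_ ?_ ?_
    · rintro s t hst ⟨C, hC⟩
      exact ⟨C, fun f M h1 h2 h3 => (eLpNorm_mono_measure _ (Measure.restrict_mono
        (Set.inter_subset_inter_right _ hst) le_rfl)).trans (hC f M h1 h2 h3)⟩
    · rintro s t ⟨C, hC⟩ ⟨C', hC'⟩
      refine ⟨C + C', fun f M h1 h2 h3 => ?_⟩
      rw [Set.inter_union_distrib_left, ENNReal.coe_add, add_mul]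
      exact (eLpNorm_restrict_union_le (fact_one_le_critExp d).out critExp_ne_top _ _).trans
        (add_le_add (hC f M h1 h2 h3) (hC' f M h1 h2 h3))
    · intro x hx
      obtain ⟨r, C, hr, hC⟩ := (hΩ.hasInnerCone hx).exists_local_sobolev hΩ.isOpen
      exact ⟨_, mem_nhdsWithin_of_mem_nhds (Metric.ball_mem_nhds x hr), C, hC⟩
  rwa [Set.inter_eq_left.2 subset_closure] at h

/-- The Poincaré-Sobolev inequality on a bounded Lipschitz domain. -/
theorem IsBoundedLipschitzDomain.exists_poincare_sobolev [Fact (2 ≤ d)] {Ω : Set (E d)}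
    (hΩ : IsBoundedLipschitzDomain Ω) :
    ∃ C : ℝ≥0, ∀ (f : E d → ℝ) (M : ℝ≥0), Measurable f → IntegrableOn f Ω → TransBound Ω f M →
      ∃ c : ℝ, eLpNorm (fun x => f x - c) (critExp d) (volume.restrict Ω) ≤ C * M := by
  obtain ⟨C₁, h₁⟩ := hΩ.exists_poincare
  obtain ⟨C₂, h₂⟩ := hΩ.exists_sobolev
  refine ⟨C₂ * (1 + C₁), fun f M hfm hf hM => ?_⟩
  obtain ⟨c, hc⟩ := h₁ f M hfm hM
  refine ⟨c, ?_⟩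
  have hc' : IntegrableOn (fun x => f x - c) Ω := by
    refine hf.sub ?_
    exact integrableOn_const hΩ.isBounded.measure_lt_top.ne
  -- Difference quotients ignore the constant `c`, and the Poincaré inequality absorbs the `L¹`
  -- term.
  refine (h₂ (fun x => f x - c) M (hfm.sub_const c) hc' ?_).trans ?_
  · intro A h hA hAΩ
    simpa using hM A h hA hAΩ
  · push_cast
    rw [mul_assoc, add_mul, one_mul]
    gcongr

/-! ### Riesz representation and weak sequential compactness -/

section Riesz

variable {α : Type*} {mα : MeasurableSpace α} {μ : Measure α} [IsFiniteMeasure μ] {p q : ℝ≥0∞}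

open Classical in
/-- The indicator function of a measurable set as an element of `L^p`. -/
noncomputable def indLp (μ : Measure α) [IsFiniteMeasure μ] (p : ℝ≥0∞) (A : Set α) : Lp ℝ p μ :=
  if h : MeasurableSet A then indicatorConstLp p h (measure_ne_top μ A) 1 else 0

lemma indLp_of_measurableSet {A : Set α} (h : MeasurableSet A) :
    indLp μ p A = indicatorConstLp p h (measure_ne_top μ A) 1 := dif_pos h

lemma coeFn_indLp {A : Set α} (h : MeasurableSet A) :
    indLp μ p A =ᵐ[μ] A.indicator fun _ => (1 : ℝ) := by
  rw [indLp_of_measurableSet h]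
  exact indicatorConstLp_coeFn

lemma sum_indLp {A : ℕ → Set α} (hA : ∀ i, MeasurableSet (A i))
    (hd : Pairwise (Function.onFun Disjoint A)) (s : Finset ℕ) :
    ∑ i ∈ s, indLp μ p (A i) = indLp μ p (⋃ i ∈ s, A i) := by
  induction s using Finset.induction_on with
  | empty => simp [indLp]
  | insert i s hi ih =>
    have hs : MeasurableSet (⋃ i ∈ s, A i) := s.measurableSet_biUnion fun i _ => hA i
    have hdisj : A i ∩ ⋃ i ∈ s, A i = ∅ := by
      refine Set.disjoint_iff_inter_eq_empty.1 ?_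
      refine Set.disjoint_iUnion₂_right.2 fun j hj => hd ?_
      rintro rfl
      exact hi hj
    rw [Finset.sum_insert hi, ih, Finset.set_biUnion_insert,
      indLp_of_measurableSet (hA i), indLp_of_measurableSet hs,
      indLp_of_measurableSet ((hA i).union hs)]
    exact (indicatorConstLp_disjoint_union (hA i) hs _ _
      (Set.disjoint_iff_inter_eq_empty.2 hdisj) 1).symm

variable [hp1 : Fact (1 ≤ p)]

/-- The sets left out by finite partial unions have measure tending to zero, which for `p < ∞` gives
convergence in norm. This is the countable additivity of `A ↦ ℓ(𝟙_A)`. -/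
lemma hasSum_indLp (hp : p ≠ ∞) {A : ℕ → Set α} (hA : ∀ i, MeasurableSet (A i))
    (hd : Pairwise (Function.onFun Disjoint A)) :
    HasSum (fun i => indLp μ p (A i)) (indLp μ p (⋃ i, A i)) := by
  have hU : MeasurableSet (⋃ i, A i) := MeasurableSet.iUnion hA
  have hs : ∀ s : Finset ℕ, MeasurableSet (⋃ i ∈ s, A i) := fun s =>
    s.measurableSet_biUnion fun i _ => hA i
  have h : Tendsto (fun s : Finset ℕ => indicatorConstLp p (hs s) (measure_ne_top μ _) (1 : ℝ))
      atTop (𝓝 (indicatorConstLp p hU (measure_ne_top μ _) 1)) := by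
    refine tendsto_indicatorConstLp_set hp ?_
    have h1 : ∀ s : Finset ℕ, μ (symmDiff (⋃ i ∈ s, A i) (⋃ i, A i)) =
        μ (⋃ i, A i) - ∑ i ∈ s, μ (A i) := by
      intro s
      have hsub : (⋃ i ∈ s, A i) ⊆ ⋃ i, A i := Set.iUnion₂_subset fun i _ =>
        Set.subset_iUnion A i
      rw [symmDiff_of_le hsub, measure_sdiff hsub (hs s).nullMeasurableSet (measure_ne_top μ _),
        measure_biUnion_finset (fun i _ j _ hij => hd hij) fun i _ => hA i]
    simp only [h1]
    have h2 : Tendsto (fun s : Finset ℕ => ∑ i ∈ s, μ (A i)) atTop (𝓝 (μ (⋃ i, A i))) := by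
      rw [measure_iUnion hd hA]
      exact ENNReal.summable.hasSum
    have := ENNReal.Tendsto.sub (tendsto_const_nhds (x := μ (⋃ i, A i))) h2
      (Or.inl (measure_ne_top μ _))
    simpa using this
  rw [HasSum, indLp_of_measurableSet hU]
  refine h.congr fun s => ?_
  rw [sum_indLp hA hd, indLp_of_measurableSet (hs s)]

/-- The signed measure `A ↦ ℓ(𝟙_A)`. -/
noncomputable def signedMeasureOfDual (hp : p ≠ ∞) (ℓ : StrongDual ℝ (Lp ℝ p μ)) :
    SignedMeasure α where
  measureOf' A := ℓ (indLp μ p A)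
  empty' := by simp [indLp]
  not_measurable' A hA := by simp [indLp, hA]
  m_iUnion' _ hA hd := (hasSum_indLp hp hA hd).mapL ℓ

lemma signedMeasureOfDual_absolutelyContinuous (hp : p ≠ ∞) (ℓ : StrongDual ℝ (Lp ℝ p μ)) :
    VectorMeasure.AbsolutelyContinuous (signedMeasureOfDual hp ℓ) μ.toENNRealVectorMeasure := by
  refine VectorMeasure.AbsolutelyContinuous.mk fun A hA h0 => ?_
  rw [Measure.toENNRealVectorMeasure_apply_measurable hA] at h0
  change ℓ (indLp μ p A) = 0
  have : indLp μ p A = 0 := by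
    rw [Lp.eq_zero_iff_ae_eq_zero]
    refine (coeFn_indLp hA).trans (indicator_meas_zero h0)
  rw [this, map_zero]

/-- The density that represents a functional on `L^p`. -/
noncomputable def dualDensity (hp : p ≠ ∞) (ℓ : StrongDual ℝ (Lp ℝ p μ)) : α → ℝ :=
  (signedMeasureOfDual hp ℓ).rnDeriv μ

lemma measurable_dualDensity (hp : p ≠ ∞) (ℓ : StrongDual ℝ (Lp ℝ p μ)) :
    Measurable (dualDensity hp ℓ) :=
  SignedMeasure.measurable_rnDeriv _ _

lemma integrable_dualDensity (hp : p ≠ ∞) (ℓ : StrongDual ℝ (Lp ℝ p μ)) :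
    Integrable (dualDensity hp ℓ) μ :=
  SignedMeasure.integrable_rnDeriv _ _

lemma setIntegral_dualDensity (hp : p ≠ ∞) (ℓ : StrongDual ℝ (Lp ℝ p μ)) {A : Set α}
    (hA : MeasurableSet A) : ∫ x in A, dualDensity hp ℓ x ∂μ = ℓ (indLp μ p A) := by
  have h := SignedMeasure.withDensityᵥ_rnDeriv_eq _ μ
    (signedMeasureOfDual_absolutelyContinuous hp ℓ)
  rw [← withDensityᵥ_apply (integrable_dualDensity hp ℓ) hA, dualDensity, h]
  rfl

lemma dual_apply_simpleFunc (hp : p ≠ ∞) (ℓ : StrongDual ℝ (Lp ℝ p μ)) (f : SimpleFunc α ℝ) :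
    ∀ hf : MemLp f p μ, ℓ (hf.toLp f) = ∫ x, f x * dualDensity hp ℓ x ∂μ := by
  induction f using SimpleFunc.induction with
  | @const c s hs =>
    intro hf
    have h1 : hf.toLp = c • indLp μ p s := by
      refine Lp.ext ?_
      filter_upwards [hf.coeFn_toLp, Lp.coeFn_smul c (indLp μ p s), coeFn_indLp (p := p) hs]
        with x h1 h2 h3
      rw [h1, h2, Pi.smul_apply, h3]
      by_cases hx : x ∈ s <;> simp [hx]
    rw [h1, map_smul, ← setIntegral_dualDensity hp ℓ hs, smul_eq_mul, ← integral_const_mul,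
      ← integral_indicator hs]
    refine integral_congr_ae (Eventually.of_forall fun x => ?_)
    by_cases hx : x ∈ s <;> simp [hx]
  | @add f g _ hf hg =>
    intro hfg
    have hfm : MemLp f p μ := f.memLp_of_isFiniteMeasure p μ
    have hgm : MemLp g p μ := g.memLp_of_isFiniteMeasure p μ
    have h1 : hfg.toLp = hfm.toLp + hgm.toLp := rfl
    have hint : ∀ f : SimpleFunc α ℝ, Integrable (fun x => f x * dualDensity hp ℓ x) μ := by
      intro f
      obtain ⟨C, hC⟩ := f.exists_forall_norm_le
      exact (integrable_dualDensity hp ℓ).bdd_mul f.stronglyMeasurable.aestronglyMeasurable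
        (Eventually.of_forall hC)
    rw [h1, map_add, hf, hg, ← integral_add (hint f) (hint g)]
    refine integral_congr_ae (Eventually.of_forall fun x => ?_)
    simp [add_mul]

variable [hq1 : Fact (1 ≤ q)]

/-- Test `ℓ` on `sign(g) e ^ (Q - 1)`, where the simple function `e` increases to `|g|`. With `I = ∫
e ^ Q` this gives `I ≤ ‖ℓ‖ I ^ (1 / P)`, hence `I ≤ ‖ℓ‖ ^ Q`, and Fatou's lemma concludes. -/
lemma memLp_dualDensity (hp : p ≠ ∞) (hpq : Real.HolderConjugate p.toReal q.toReal)
    (ℓ : StrongDual ℝ (Lp ℝ p μ)) : MemLp (dualDensity hp ℓ) q μ := by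
  set g := dualDensity hp ℓ with hg
  have hgm : Measurable g := measurable_dualDensity hp ℓ
  set P := p.toReal
  set Q := q.toReal
  have hp0 : p ≠ 0 := (one_pos.trans_le hp1.out).ne'
  have hq0 : q ≠ 0 := (one_pos.trans_le hq1.out).ne'
  have hqt : q ≠ ∞ := fun h => by
    have := hpq.symm.pos
    simp [Q, h] at this
  have hQ0 : 0 < Q := hpq.symm.pos
  have hP0 : 0 < P := hpq.pos
  have hQ1 : 0 < Q - 1 := hpq.symm.sub_one_pos
  set e : ℕ → SimpleFunc α ℝ≥0∞ := SimpleFunc.eapprox fun x => ‖g x‖ₑ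
  have hefin : ∀ n x, e n x ≠ ∞ := fun n x => (SimpleFunc.eapprox_lt_top _ n x).ne
  have hele : ∀ n x, e n x ≤ ‖g x‖ₑ := by
    intro n x
    rw [← SimpleFunc.iSup_eapprox_apply hgm.enorm x]
    exact le_iSup (fun n => e n x) n
  have hbound : ∀ n, ∫⁻ x, e n x ^ Q ∂μ ≤ ‖ℓ‖ₑ ^ Q := by
    intro n
    set s : SimpleFunc α ℝ := SimpleFunc.piecewise {x | 0 ≤ g x}
      (measurableSet_le measurable_const hgm) (SimpleFunc.const α 1) (SimpleFunc.const α (-1))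
    set h : SimpleFunc α ℝ := (e n).map fun t => t.toReal ^ (Q - 1)
    set k : SimpleFunc α ℝ := s * h with hk
    have hkm : MemLp k p μ := k.memLp_of_isFiniteMeasure p μ
    have hs : ∀ x, s x * g x = ‖g x‖ := by
      intro x
      by_cases hx : 0 ≤ g x
      · simp [s, hx, abs_of_nonneg hx]
      · simp [s, hx, abs_of_neg (not_le.1 hx)]
    have hs1 : ∀ x, ‖s x‖ = 1 := by
      intro x
      by_cases hx : 0 ≤ g x <;> simp [s, hx]
    have hh0 : ∀ x, 0 ≤ h x := fun x => Real.rpow_nonneg ENNReal.toReal_nonneg _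
    have hhe : ∀ x, ENNReal.ofReal (h x) = e n x ^ (Q - 1) := by
      intro x
      change ENNReal.ofReal ((e n x).toReal ^ (Q - 1)) = _
      rw [← ENNReal.ofReal_rpow_of_nonneg ENNReal.toReal_nonneg hQ1.le,
        ENNReal.ofReal_toReal (hefin n x)]
    have hkg : ∀ x, k x * g x = h x * ‖g x‖ := by
      intro x
      rw [← hs x, hk, SimpleFunc.mul_apply]
      ring
    have hkn : ∀ x, ‖k x‖ₑ = e n x ^ (Q - 1) := by
      intro x
      rw [← ofReal_norm, hk, SimpleFunc.mul_apply, norm_mul, hs1, one_mul,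
        Real.norm_of_nonneg (hh0 x), hhe]
    set I := ∫⁻ x, e n x ^ Q ∂μ with hI
    -- Finiteness, from a bounded function on a finite measure space, is what permits cancelling `I
    -- ^ (1 / P)`.
    have hIfin : I ≠ ∞ := by
      have h1 : (fun x => e n x ^ Q) = (e n).map fun t => t ^ Q := rfl
      have h2 : ∀ x, ((e n).map fun t => t ^ Q) x < ∞ := fun x =>
        ENNReal.rpow_lt_top_of_nonneg hQ0.le (hefin n x)
      rw [hI]
      obtain ⟨C, hC, hCle⟩ : ∃ C : ℝ≥0∞, C < ∞ ∧ ∀ x, e n x ^ Q ≤ C := by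
        refine ⟨((e n).map fun t => t ^ Q).range.sup id, ?_, fun x => ?_⟩
        · rw [Finset.sup_lt_iff ENNReal.zero_lt_top]
          intro y hy
          obtain ⟨x, rfl⟩ := SimpleFunc.mem_range.1 hy
          exact h2 x
        · exact Finset.le_sup (f := id) (SimpleFunc.mem_range_self ((e n).map fun t => t ^ Q) x)
      refine ((lintegral_mono hCle).trans_lt ?_).ne
      rw [lintegral_const]
      exact ENNReal.mul_lt_top hC (measure_lt_top μ _)
    have hlow : I ≤ ENNReal.ofReal (ℓ (hkm.toLp k)) := by
      rw [dual_apply_simpleFunc hp ℓ k hkm]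
      simp only [← hg, hkg]
      rw [ofReal_integral_eq_lintegral_ofReal]
      · refine lintegral_mono fun x => ?_
        rw [ENNReal.ofReal_mul (hh0 x), hhe, ofReal_norm]
        calc e n x ^ Q = e n x ^ (Q - 1) * e n x ^ (1 : ℝ) := by
              rw [← ENNReal.rpow_add_of_nonneg _ _ hQ1.le zero_le_one, sub_add_cancel]
          _ ≤ _ := by
              rw [ENNReal.rpow_one]
              exact mul_le_mul_right (hele n x) _
      · obtain ⟨C, hC⟩ := h.exists_forall_norm_le
        exact (integrable_dualDensity hp ℓ).norm.bdd_mul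
          h.stronglyMeasurable.aestronglyMeasurable (Eventually.of_forall hC)
      · exact Eventually.of_forall fun x => mul_nonneg (hh0 x) (norm_nonneg _)
    have hup : ENNReal.ofReal (ℓ (hkm.toLp k)) ≤ ‖ℓ‖ₑ * I ^ (1 / P) := by
      calc ENNReal.ofReal (ℓ (hkm.toLp k)) ≤ ‖ℓ (hkm.toLp k)‖ₑ := by
            rw [← ofReal_norm]
            exact ENNReal.ofReal_le_ofReal (le_abs_self _)
        _ ≤ ‖ℓ‖ₑ * ‖hkm.toLp k‖ₑ := ℓ.le_opENorm _
        _ = _ := by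
            rw [Lp.enorm_toLp, eLpNorm_eq_lintegral_rpow_enorm_toReal hp0 hp, hI]
            congr 2
            refine lintegral_congr fun x => ?_
            rw [hkn, ← ENNReal.rpow_mul, hpq.symm.sub_one_mul_conj]
    have hmain := hlow.trans hup
    rcases eq_or_ne I 0 with h0 | h0
    · rw [h0]; exact zero_le
    · have hsplit : I = I ^ (1 / Q) * I ^ (1 / P) := by
        rw [← ENNReal.rpow_add_of_nonneg _ _ (by positivity) (by positivity), one_div, one_div,
          add_comm, hpq.inv_add_inv_eq_one, ENNReal.rpow_one]
      have hne0 : I ^ (1 / P) ≠ 0 := by simp [ENNReal.rpow_eq_zero_iff, h0, hIfin]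
      have hnet : I ^ (1 / P) ≠ ∞ := ENNReal.rpow_ne_top_of_nonneg (by positivity) hIfin
      have h1 : I ^ (1 / Q) ≤ ‖ℓ‖ₑ := by
        have h2 : I ^ (1 / Q) * I ^ (1 / P) ≤ ‖ℓ‖ₑ * I ^ (1 / P) := hsplit ▸ hmain
        exact (ENNReal.mul_le_mul_iff_left hne0 hnet).1 h2
      have h3 := ENNReal.rpow_le_rpow h1 hQ0.le
      rwa [← ENNReal.rpow_mul, one_div_mul_cancel hQ0.ne', ENNReal.rpow_one] at h3
  refine ⟨hgm.aestronglyMeasurable, ?_⟩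
  rw [eLpNorm_eq_lintegral_rpow_enorm_toReal hq0 hqt]
  refine ENNReal.rpow_lt_top_of_nonneg (by positivity) (ne_of_lt ?_)
  have hlim : ∀ x, liminf (fun n => e n x ^ Q) atTop = ‖g x‖ₑ ^ Q := fun x =>
    ((ENNReal.continuous_rpow_const.tendsto _).comp
      (SimpleFunc.tendsto_eapprox hgm.enorm x)).liminf_eq
  calc ∫⁻ x, ‖g x‖ₑ ^ Q ∂μ = ∫⁻ x, liminf (fun n => e n x ^ Q) atTop ∂μ :=
        lintegral_congr fun x => (hlim x).symm
    _ ≤ liminf (fun n => ∫⁻ x, e n x ^ Q ∂μ) atTop :=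
        lintegral_liminf_le fun n => (e n).measurable.pow_const Q
    _ ≤ ‖ℓ‖ₑ ^ Q := liminf_le_of_forall_le hbound
    _ < ∞ := ENNReal.rpow_lt_top_of_nonneg hQ0.le enorm_ne_top

/-- The Riesz representation of the functionals on `L^p`, for `1 < p < ∞` and a finite measure. -/
theorem exists_lpPairing_eq [ENNReal.HolderConjugate p q] (hp : p ≠ ∞)
    (hpq : Real.HolderConjugate p.toReal q.toReal) (ℓ : StrongDual ℝ (Lp ℝ p μ)) :
    ∃ g : Lp ℝ q μ, ∀ f : Lp ℝ p μ,
      ℓ f = (ContinuousLinearMap.mul ℝ ℝ).lpPairing μ p q f g := by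
  have hg := memLp_dualDensity hp hpq ℓ
  refine ⟨hg.toLp, fun f => ?_⟩
  refine Lp.induction hp (motive := fun f => ℓ f =
    (ContinuousLinearMap.mul ℝ ℝ).lpPairing μ p q f hg.toLp) ?_ ?_ ?_ f
  · intro c s hs hμs
    have h1 : ((Lp.simpleFunc.indicatorConst p hs hμs.ne c : Lp.simpleFunc ℝ p μ) : Lp ℝ p μ) =
        c • indLp μ p s := by
      rw [Lp.simpleFunc.coe_indicatorConst]
      refine Lp.ext ?_
      filter_upwards [indicatorConstLp_coeFn (p := p) (hs := hs) (hμs := hμs.ne) (c := c),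
        Lp.coeFn_smul c (indLp μ p s), coeFn_indLp (p := p) hs] with x h1 h2 h3
      rw [h1, h2, Pi.smul_apply, h3]
      by_cases hx : x ∈ s <;> simp [hx]
    rw [h1, map_smul, map_smul, smul_apply]
    congr 1
    rw [ContinuousLinearMap.lpPairing_eq_integral, ← setIntegral_dualDensity hp ℓ hs,
      ← integral_indicator hs]
    refine integral_congr_ae ?_
    filter_upwards [hg.coeFn_toLp, coeFn_indLp (p := p) hs] with x h1 h2
    rw [h1, h2]
    by_cases hx : x ∈ s <;> simp [hx]
  · intro f g hf hg _ h1 h2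
    rw [map_add, map_add, add_apply, h1, h2]
  · exact isClosed_eq ℓ.continuous
      (((ContinuousLinearMap.mul ℝ ℝ).lpPairing μ p q).flip hg.toLp).continuous

lemma tendsto_toWeakSpace_iff {X : Type*} [NormedAddCommGroup X] [NormedSpace ℝ X] {u : ℕ → X}
    {x : X} : Tendsto (fun n => toWeakSpace ℝ X (u n)) atTop (𝓝 (toWeakSpace ℝ X x)) ↔
      ∀ ℓ : StrongDual ℝ X, Tendsto (fun n => ℓ (u n)) atTop (𝓝 (ℓ x)) := by
  have hinj : Function.Injective (topDualPairing ℝ X).flip := by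
    intro x y hxy
    exact (SeparatingDual.eq_iff_forall_dual_eq (R := ℝ)).2 fun ℓ => LinearMap.congr_fun hxy ℓ
  exact WeakBilin.tendsto_iff_forall_eval_tendsto _ hinj

/-- Bounded sequences in `L^p`, `1 < p < ∞`, have weakly convergent subsequences. -/
theorem exists_subseq_tendsto_weakly [ENNReal.HolderConjugate p q] (hp : p ≠ ∞) (hq : q ≠ ∞)
    (hpq : Real.HolderConjugate p.toReal q.toReal)
    [TopologicalSpace.SeparableSpace (Lp ℝ q μ)] {u : ℕ → Lp ℝ p μ} {R : ℝ}
    (hu : ∀ n, ‖u n‖ ≤ R) :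
    ∃ (v : Lp ℝ p μ) (φ : ℕ → ℕ), StrictMono φ ∧
      Tendsto (fun n => toWeakSpace ℝ (Lp ℝ p μ) (u (φ n))) atTop
        (𝓝 (toWeakSpace ℝ (Lp ℝ p μ) v)) := by
  have : ENNReal.HolderConjugate q p := ENNReal.HolderTriple.symm
  -- View `L^p` as functionals on the separable space `L^q` and extract a weak-* limit. Riesz for
  -- `L^q` represents that limit by some `v ∈ L^p`; Riesz for `L^p` turns each functional into a `g
  -- ∈ L^q`, so the convergence is weak in `L^p`.
  set B := (ContinuousLinearMap.mul ℝ ℝ).lpPairing μ p q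
  set B' := (ContinuousLinearMap.mul ℝ ℝ).lpPairing μ q p
  have hBB : ∀ f g, B f g = B' g f := by
    intro f g
    simp only [B, B', ContinuousLinearMap.lpPairing_eq_integral, ContinuousLinearMap.mul_apply']
    simp only [mul_comm]
  have hmem : ∀ n, StrongDual.toWeakDual (B (u n)) ∈
      WeakDual.toStrongDual ⁻¹' Metric.closedBall (0 : StrongDual ℝ (Lp ℝ q μ)) (‖B‖ * R) := by
    intro n
    change B (u n) ∈ Metric.closedBall _ _
    rw [mem_closedBall_zero_iff]
    exact (B.le_opNorm _).trans (mul_le_mul_of_nonneg_left (hu n) (norm_nonneg _))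
  obtain ⟨ξ, -, φ, hφ, hlim⟩ := WeakDual.isSeqCompact_closedBall ℝ _ _ _ hmem
  obtain ⟨v, hv⟩ := exists_lpPairing_eq (p := q) (q := p) hq hpq.symm (WeakDual.toStrongDual ξ)
  refine ⟨v, φ, hφ, tendsto_toWeakSpace_iff.2 fun ℓ => ?_⟩
  obtain ⟨g, hg⟩ := exists_lpPairing_eq hp hpq ℓ
  have h1 := (tendsto_iff_forall_eval_tendsto_topDualPairing.1 hlim) g
  have h2 : topDualPairing ℝ (Lp ℝ q μ) ξ g = ℓ v := by
    rw [hg, hBB]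
    exact hv g
  rw [h2] at h1
  refine h1.congr fun n => ?_
  exact (hg (u (φ n))).symm

end Riesz

/-! ### Functions of bounded variation as elements of L^q -/

lemma TV_congr_ae {Ω : Set (E d)} {u v : E d → ℝ} (h : u =ᵐ[volume.restrict Ω] v) :
    TV Ω u = TV Ω v := by
  unfold TV
  refine iSup_congr fun ψ => iSup_congr fun _ => congrArg ENNReal.ofReal ?_
  refine integral_congr_ae ?_
  filter_upwards [h] with x hx
  rw [hx]

lemma coeFn_oneLq {Ω : Set (E d)} (hΩ : Bornology.IsBounded Ω) :
    oneLq hΩ =ᵐ[volume.restrict Ω] fun _ => (1 : ℝ) := by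
  have : IsFiniteMeasure ((volume : Measure (E d)).restrict Ω) :=
    isFiniteMeasure_restrict.mpr hΩ.measure_lt_top.ne
  exact Lp.coeFn_const ..

lemma continuous_divergence {ψ : E d → E d} (hψ : ContDiff ℝ 1 ψ) : Continuous (divergence ψ) := by
  have := hψ.continuous_fderiv one_ne_zero
  unfold divergence
  fun_prop

lemma hasCompactSupport_divergence {ψ : E d → E d} (hψ : HasCompactSupport ψ) :
    HasCompactSupport (divergence ψ) :=
  (hψ.fderiv ℝ).comp_left
    (g := fun A : E d →L[ℝ] E d => ∑ i : Fin d, (A (EuclideanSpace.single i 1)) i) (by simp)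

section Lq

variable [hd : Fact (2 ≤ d)] {Ω : Set (E d)}

lemma integrableOn_coeFn (hΩ : Bornology.IsBounded Ω) (u : LqSpace d Ω) : IntegrableOn u Ω := by
  have : IsFiniteMeasure ((volume : Measure (E d)).restrict Ω) :=
    isFiniteMeasure_restrict.mpr hΩ.measure_lt_top.ne
  exact (Lp.memLp u).integrable (fact_one_le_critExp d).out

/-- The Poincaré-Sobolev inequality for functions of bounded variation. -/
theorem IsBoundedLipschitzDomain.exists_norm_sub_smul_oneLq_le
    (hΩ : IsBoundedLipschitzDomain Ω) :
    ∃ C : ℝ≥0, ∀ u : LqSpace d Ω, TV Ω u ≠ ∞ →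
      ∃ c : ℝ, ‖u - c • oneLq hΩ.isBounded‖ ≤ C * (TV Ω u).toReal := by
  obtain ⟨C, hC⟩ := hΩ.exists_poincare_sobolev
  refine ⟨C, fun u hu => ?_⟩
  -- `transBound_TV` asks for a function measurable everywhere and zero off `Ω`, so a measurable
  -- representative is chosen and cut off.
  set f₀ : E d → ℝ := (Lp.aestronglyMeasurable u).mk u
  set f : E d → ℝ := Ω.indicator f₀
  have hmΩ := hΩ.isOpen.measurableSet
  have hfu : f =ᵐ[volume.restrict Ω] u :=
    (indicator_ae_eq_restrict hmΩ).trans (Lp.aestronglyMeasurable u).ae_eq_mk.symm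
  have hfm : Measurable f :=
    (Lp.aestronglyMeasurable u).stronglyMeasurable_mk.measurable.indicator hmΩ
  have hfi : IntegrableOn f Ω := (integrableOn_coeFn hΩ.isBounded u).congr hfu.symm
  have hfi' : Integrable f := by
    rw [← integrable_indicator_iff hmΩ] at hfi
    rwa [Set.indicator_indicator, Set.inter_self] at hfi
  have hTV : TV Ω f = TV Ω u := TV_congr_ae hfu
  have htr := transBound_TV hfm hfi' (fun x hx => Set.indicator_of_notMem hx _) (hTV ▸ hu)
  obtain ⟨c, hc⟩ := hC f _ hfm hfi htr
  refine ⟨c, ?_⟩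
  have h1 : eLpNorm (u - c • oneLq hΩ.isBounded : LqSpace d Ω) (critExp d)
      (volume.restrict Ω) = eLpNorm (fun x => f x - c) (critExp d) (volume.restrict Ω) := by
    refine eLpNorm_congr_ae ?_
    filter_upwards [hfu, Lp.coeFn_sub u (c • oneLq hΩ.isBounded),
      Lp.coeFn_smul c (oneLq hΩ.isBounded), coeFn_oneLq hΩ.isBounded] with x h1 h2 h3 h4
    rw [h2, Pi.sub_apply, h3, Pi.smul_apply, h4, h1, smul_eq_mul, mul_one]
  rw [Lp.norm_def, h1, ← hTV]
  refine (ENNReal.toReal_mono ?_ hc).trans_eq ?_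
  · exact ENNReal.mul_ne_top ENNReal.coe_ne_top ENNReal.coe_ne_top
  · rw [ENNReal.toReal_mul, ENNReal.coe_toReal, ENNReal.coe_toReal]
    rfl

instance holderConjugate_critExp : ENNReal.HolderConjugate (critExp d) d :=
  ENNReal.HolderConjugate.of_toReal (by
    rw [ENNReal.toReal_natCast]; exact holderConjugate_toReal_critExp.symm)

instance fact_one_le_natCast : Fact ((1 : ℝ≥0∞) ≤ d) :=
  ⟨by exact_mod_cast (one_le_two.trans hd.out)⟩

lemma exists_weak_subseq (hΩ : Bornology.IsBounded Ω) {u : ℕ → LqSpace d Ω} {R : ℝ}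
    (hu : ∀ n, ‖u n‖ ≤ R) :
    ∃ (v : LqSpace d Ω) (φ : ℕ → ℕ), StrictMono φ ∧
      Tendsto (fun n => toWeakSpace ℝ (LqSpace d Ω) (u (φ n))) atTop
        (𝓝 (toWeakSpace ℝ (LqSpace d Ω) v)) := by
  have : IsFiniteMeasure ((volume : Measure (E d)).restrict Ω) :=
    isFiniteMeasure_restrict.mpr hΩ.measure_lt_top.ne
  have : Fact ((d : ℝ≥0∞) ≠ ∞) := ⟨ENNReal.natCast_ne_top d⟩
  refine exists_subseq_tendsto_weakly (q := d) critExp_ne_top (ENNReal.natCast_ne_top d) ?_ hu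
  rw [ENNReal.toReal_natCast]
  exact holderConjugate_toReal_critExp.symm

/-- Testing with the divergence of a fixed field is weakly continuous. -/
lemma tendsto_integral_mul_divergence {u : ℕ → LqSpace d Ω} {v : LqSpace d Ω}
    (h : Tendsto (fun n => toWeakSpace ℝ (LqSpace d Ω) (u n)) atTop
        (𝓝 (toWeakSpace ℝ (LqSpace d Ω) v))) {ψ : E d → E d} (hψ : ψ ∈ testFields Ω) :
    Tendsto (fun n => ∫ x in Ω, u n x * divergence ψ x) atTop
      (𝓝 (∫ x in Ω, v x * divergence ψ x)) := by
  have hm : MemLp (divergence ψ) d (volume.restrict Ω) :=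
    ((continuous_divergence hψ.1).memLp_of_hasCompactSupport
      (hasCompactSupport_divergence hψ.2.1)).restrict Ω
  have hpair : ∀ w : LqSpace d Ω, (ContinuousLinearMap.mul ℝ ℝ).lpPairing (volume.restrict Ω)
      (critExp d) d w hm.toLp = ∫ x in Ω, w x * divergence ψ x := by
    intro w
    rw [ContinuousLinearMap.lpPairing_eq_integral]
    refine integral_congr_ae ?_
    filter_upwards [hm.coeFn_toLp] with x hx
    rw [hx, ContinuousLinearMap.mul_apply']
  have := tendsto_toWeakSpace_iff.1 h (((ContinuousLinearMap.mul ℝ ℝ).lpPairing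
    (volume.restrict Ω) (critExp d) d).flip hm.toLp)
  simpa only [ContinuousLinearMap.flip_apply, hpair] using this

end Lq

/-! ### Coercivity of convex functions along a line -/

section Convex

variable {Y : Type*} [NormedAddCommGroup Y] [NormedSpace ℝ Y] {F : Y → ℝ}

/-- Convexity forces at least linear growth along `k`, so `F` exceeds a level `M'` at `y₀ + T k`,
and by continuity at `y n + T k` for large `n`. If `c n > T`, that point lies between `y n` and `y n
+ c n k`, where `F ≤ M'`: a contradiction. -/
lemma eventually_le_of_convexOn (hF : ConvexOn ℝ Set.univ F) (hFc : Continuous F)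
    {y : ℕ → Y} {y₀ k : Y} (hy : Tendsto y atTop (𝓝 y₀)) (hk : F y₀ < F (y₀ + k))
    {c : ℕ → ℝ} {M : ℝ} (hM : ∀ n, F (y n + c n • k) ≤ M) : ∃ T : ℝ, ∀ᶠ n in atTop, c n ≤ T := by
  -- The level `F y₀ + 1` eventually dominates `F (y n)`, so `M'` bounds both ends of the segment.
  set M' := max M (F y₀ + 1) with hM'
  have hδ : 0 < F (y₀ + k) - F y₀ := sub_pos.2 hk
  obtain ⟨T, hT1, hT⟩ : ∃ T : ℝ, 1 ≤ T ∧ M' < F y₀ + T * (F (y₀ + k) - F y₀) := by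
    refine ⟨max 1 ((M' - F y₀) / (F (y₀ + k) - F y₀) + 1), le_max_left _ _, ?_⟩
    have h1 : (M' - F y₀) / (F (y₀ + k) - F y₀) <
        max 1 ((M' - F y₀) / (F (y₀ + k) - F y₀) + 1) :=
      (lt_add_one _).trans_le (le_max_right _ _)
    rw [div_lt_iff₀ hδ] at h1
    linarith
  have hTpos : 0 < T := one_pos.trans_le hT1
  have hgrow : M' < F (y₀ + T • k) := by
    have h1 := hF.2 (Set.mem_univ y₀) (Set.mem_univ (y₀ + T • k))
      (sub_nonneg.2 (inv_le_one_of_one_le₀ hT1)) (inv_nonneg.2 hTpos.le) (by ring)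
    have h2 : (1 - T⁻¹) • y₀ + T⁻¹ • (y₀ + T • k) = y₀ + k := by
      rw [smul_add, inv_smul_smul₀ hTpos.ne']; module
    rw [h2, smul_eq_mul, smul_eq_mul] at h1
    have h3 := mul_le_mul_of_nonneg_left h1 hTpos.le
    have h4 : T * ((1 - T⁻¹) * F y₀ + T⁻¹ * F (y₀ + T • k)) =
        T * F y₀ - F y₀ + F (y₀ + T • k) := by
      field_simp
    rw [h4] at h3
    linarith
  refine ⟨T, ?_⟩
  have e1 : ∀ᶠ n in atTop, M' < F (y n + T • k) :=
    ((hFc.tendsto _).comp (hy.add_const (T • k))).eventually_const_lt hgrow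
  have e2 : ∀ᶠ n in atTop, F (y n) < F y₀ + 1 :=
    ((hFc.tendsto _).comp hy).eventually_lt_const (lt_add_one _)
  filter_upwards [e1, e2] with n h1 h2
  by_contra hc
  rw [not_le] at hc
  have hcpos : 0 < c n := hTpos.trans hc
  have hseg : y n + T • k ∈ segment ℝ (y n) (y n + c n • k) := by
    rw [segment_eq_image']
    refine ⟨T / c n, ⟨by positivity, (div_le_one hcpos).2 hc.le⟩, ?_⟩
    simp only [add_sub_cancel_left]
    rw [smul_smul, div_mul_cancel₀ _ hcpos.ne']
  have h3 := hF.le_on_segment (Set.mem_univ _) (Set.mem_univ _) hseg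
  have h4 : max (F (y n)) (F (y n + c n • k)) ≤ M' :=
    max_le (h2.le.trans (le_max_right _ _)) ((hM n).trans (le_max_left _ _))
  linarith

/-- Coercivity of a convex function along a line, locally uniformly in the base point. -/
lemma eventually_abs_sub_le_of_convexOn (hF : ConvexOn ℝ Set.univ F) (hFc : Continuous F)
    {y : ℕ → Y} {y₀ k : Y} (hy : Tendsto y atTop (𝓝 y₀))
    (hmin : ∃! c : ℝ, ∀ c' : ℝ, F (y₀ + c • k) ≤ F (y₀ + c' • k))
    {c : ℕ → ℝ} {M : ℝ} (hM : ∀ n, F (y n + c n • k) ≤ M) :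
    ∃ c₀ T : ℝ, ∀ᶠ n in atTop, c n ∈ Set.Icc (c₀ - T) (c₀ + T) := by
  obtain ⟨c₀, hc₀, huniq⟩ := hmin
  have hstrict : ∀ s : ℝ, s ≠ 0 → F (y₀ + c₀ • k) < F (y₀ + c₀ • k + s • k) := by
    intro s hs
    have h1 : y₀ + c₀ • k + s • k = y₀ + (c₀ + s) • k := by module
    rw [h1]
    refine (hc₀ _).lt_of_ne fun h => hs ?_
    have := huniq (c₀ + s) fun c' => h ▸ hc₀ c'
    linarith
  -- Recentred at the minimizer `c₀`, the one-sided bound applies in the directions `k` and `-k`.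
  have hy' := hy.add_const (c₀ • k)
  have h1 : F (y₀ + c₀ • k) < F (y₀ + c₀ • k + k) := by simpa using hstrict 1 one_ne_zero
  have h2 : F (y₀ + c₀ • k) < F (y₀ + c₀ • k + -k) := by
    simpa using hstrict (-1) (by norm_num)
  obtain ⟨T₁, hT₁⟩ := eventually_le_of_convexOn hF hFc hy' h1 (c := fun n => c n - c₀) (M := M)
    fun n => by
      convert hM n using 2
      module
  obtain ⟨T₂, hT₂⟩ := eventually_le_of_convexOn hF hFc hy' h2 (c := fun n => c₀ - c n) (M := M)
    fun n => by
      convert hM n using 2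
      module
  refine ⟨c₀, max T₁ T₂, ?_⟩
  filter_upwards [hT₁, hT₂] with n h3 h4
  have := le_max_left T₁ T₂
  have := le_max_right T₁ T₂
  constructor <;> linarith

end Convex

end TVMin

/-! ### The direct method -/

theorem theorem2p3 {d : ℕ} [Fact (2 ≤ d)] {Ω : Set (TVMin.E d)}
    (hΩ : TVMin.IsBoundedLipschitzDomain Ω)
    {Y : Type*} [NormedAddCommGroup Y] [InnerProductSpace ℝ Y] [CompleteSpace Y]
    [TopologicalSpace.SeparableSpace Y]
    (V : Submodule ℝ (TVMin.LqSpace d Ω)) (hV : TVMin.IsWeaklyClosed V)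
    (hone : TVMin.oneLq hΩ.isBounded ∈ V)
    (K : V →L[ℝ] Y) (F : Y → ℝ)
    (hK : TVMin.IsWeakToStrongContinuous K)
    (hF_smooth : ContDiff ℝ 3 F)
    (hF_convex : StrictConvexOn ℝ Set.univ F)
    (hF_nonneg : ∀ y : Y, 0 ≤ F y)
    (hF_shift : ∀ y : Y, ∃! c : ℝ, ∀ c' : ℝ,
      F (y + c • K ⟨TVMin.oneLq hΩ.isBounded, hone⟩) ≤
        F (y + c' • K ⟨TVMin.oneLq hΩ.isBounded, hone⟩)) :
    ∃ u : V, TVMin.IsBV Ω (u : TVMin.LqSpace d Ω) ∧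
      ∀ v : V, TVMin.objective K F u ≤ TVMin.objective K F v := by
  open TVMin in
  set one : V := ⟨oneLq hΩ.isBounded, hone⟩
  have hFc : Continuous F := hF_smooth.continuous
  -- As `F ≥ 0`, the objective can be handled in `[0, ∞]`, where infima always exist.
  set J : V → ℝ≥0∞ := fun v => ENNReal.ofReal (F (K v)) + TV Ω (v : LqSpace d Ω) with hJ
  have hobj : ∀ v, objective K F v = (J v : EReal) := by
    intro v
    rw [hJ, objective, EReal.coe_ennreal_add, EReal.coe_ennreal_ofReal,
      max_eq_left (hF_nonneg _)]
  have hJ0 : J 0 ≠ ∞ := by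
    have : TV Ω ((0 : V) : LqSpace d Ω) = 0 := by
      rw [ZeroMemClass.coe_zero, TV_congr_ae (Lp.coeFn_zero ℝ (critExp d) (volume.restrict Ω))]
      simp [TV]
    simp only [hJ, this, add_zero]
    exact ENNReal.ofReal_ne_top
  -- a minimizing sequence below the level of `0`
  obtain ⟨j, -, hjlim, hjmem⟩ := exists_seq_tendsto_sInf (S := J '' {v | J v ≤ J 0})
    ⟨J 0, 0, le_refl (J 0), rfl⟩ (OrderBot.bddBelow _)
  set m := sInf (J '' {v | J v ≤ J 0}) with hm
  have hmle : ∀ v, m ≤ J v := by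
    intro v
    rcases le_total (J v) (J 0) with h | h
    · exact sInf_le ⟨v, h, rfl⟩
    · exact (sInf_le ⟨0, le_refl (J 0), rfl⟩ : m ≤ J 0).trans h
  choose u hu0 huj using hjmem
  have huTV : ∀ n, TV Ω (u n : LqSpace d Ω) ≤ J 0 := fun n => le_add_self.trans (hu0 n)
  have huF : ∀ n, F (K (u n)) ≤ (J 0).toReal := fun n =>
    (ENNReal.ofReal_le_iff_le_toReal hJ0).1 (le_self_add.trans (hu0 n))
  -- splitting off constants
  obtain ⟨C, hC⟩ := hΩ.exists_norm_sub_smul_oneLq_le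
  choose c hc using fun n => hC (u n) (ne_top_of_le_ne_top hJ0 (huTV n))
  set w : ℕ → V := fun n => u n - c n • one with hw
  have hwb : ∀ n, ‖(w n : LqSpace d Ω)‖ ≤ C * (J 0).toReal := fun n =>
    (hc n).trans (mul_le_mul_of_nonneg_left (ENNReal.toReal_mono hJ0 (huTV n)) C.2)
  obtain ⟨v, φ, hφ, hv⟩ := exists_weak_subseq hΩ.isBounded hwb
  have hvV : v ∈ V := by
    obtain ⟨v', hv', he⟩ := hV.mem_of_tendsto hv
      (Eventually.of_forall fun n => ⟨_, (w (φ n)).2, rfl⟩)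
    rwa [← (toWeakSpace ℝ (LqSpace d Ω)).injective he]
  have hKw := hK (fun n => w (φ n)) ⟨v, hvV⟩ hv
  have hKu : ∀ n, K (w n) + c n • K one = K (u n) := by
    intro n
    rw [hw, map_sub, map_smul, sub_add_cancel]
  obtain ⟨c₀, T, hT⟩ := eventually_abs_sub_le_of_convexOn hF_convex.convexOn hFc hKw (hF_shift _)
    (c := fun n => c (φ n)) (M := (J 0).toReal) fun n => by rw [hKu]; exact huF _
  obtain ⟨a, -, θ, hθ, ha⟩ := tendsto_subseq_of_frequently_bounded
    (Metric.isBounded_Icc _ _)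
    hT.frequently
  set χ : ℕ → ℕ := fun n => φ (θ n)
  have hχ : StrictMono χ := hφ.comp hθ
  set z : V := ⟨v, hvV⟩ + a • one with hz
  have hweak : Tendsto (fun n => toWeakSpace ℝ (LqSpace d Ω) (u (χ n) : LqSpace d Ω)) atTop
      (𝓝 (toWeakSpace ℝ (LqSpace d Ω) (z : LqSpace d Ω))) := by
    refine tendsto_toWeakSpace_iff.2 fun ℓ => ?_
    have h1 := (tendsto_toWeakSpace_iff.1 hv ℓ).comp hθ.tendsto_atTop
    have h2 := h1.add (ha.mul_const (ℓ (oneLq hΩ.isBounded)))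
    refine (h2.congr fun n => ?_).trans_eq ?_
    · simp [hw, χ, one]
    · simp [hz, one]
  have hFlim : Tendsto (fun n => ENNReal.ofReal (F (K (u (χ n))))) atTop
      (𝓝 (ENNReal.ofReal (F (K z)))) :=
    ENNReal.tendsto_ofReal ((hFc.tendsto _).comp (hK _ _ hweak))
  have hJlim : Tendsto (fun n => J (u (χ n))) atTop (𝓝 m) := by
    simp only [huj]
    exact hjlim.comp hχ.tendsto_atTop
  -- Lower semicontinuity one field at a time: for fixed `ψ` both terms converge, and the supremum
  -- over `ψ` is taken only after the limit.
  have htest : ∀ ψ ∈ testFields Ω, ENNReal.ofReal (F (K z)) +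
      ENNReal.ofReal (∫ x in Ω, (z : LqSpace d Ω) x * divergence ψ x) ≤ m := by
    intro ψ hψ
    refine le_of_tendsto_of_tendsto' (hFlim.add (ENNReal.tendsto_ofReal
      (tendsto_integral_mul_divergence hweak hψ))) hJlim fun n => ?_
    exact add_le_add le_rfl (le_iSup₂_of_le ψ hψ le_rfl)
  -- This makes the truncated difference `m - F (K z)` a genuine one, so that adding `F (K z)` back
  -- gives `m`.
  have hFz : ENNReal.ofReal (F (K z)) ≤ m :=
    le_of_tendsto_of_tendsto' hFlim hJlim fun n => le_self_add
  have hTVz : TV Ω (z : LqSpace d Ω) ≤ m - ENNReal.ofReal (F (K z)) :=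
    iSup₂_le fun ψ hψ => ENNReal.le_sub_of_add_le_left ENNReal.ofReal_ne_top (htest ψ hψ)
  have hJz : J z ≤ m := (add_le_add_right hTVz _).trans_eq (add_tsub_cancel_of_le hFz)
  refine ⟨z, ⟨integrableOn_coeFn hΩ.isBounded _, ?_⟩, fun y => ?_⟩
  · exact (le_add_self.trans (hJz.trans (hmle 0))).trans_lt hJ0.lt_top
  · rw [hobj, hobj]
    exact_mod_cast hJz.trans (hmle y)
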